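/- Let $(M^3,J,\theta)$ be a three-dimensional pseudohermitian manifold: $M$ is a smooth (Hausdorff, $\sigma$-compact) three-manifold without boundary, $\theta$ is a real contact form, and $J$ is a complex structure on the contact bundle $\xi=\ker\theta$ such that the Levi form $-i\,d\theta(Z,\overline Z)$ is positive on the $+i$-eigenbundle $T_{1,0}\subset\xi\otimes\mathbb C$ of $J$. Let $T$ be the Reeb field ($\theta(T)=1$, $d\theta(T,\cdot)=0$). In a local frame $Z_1$ of $T_{1,0}$, $Z_{\bar1}=\overline{Z_1}$, with dual coframe $\{\theta,\theta^1,\theta^{\bar1}\}$ of $\{T,Z_1,Z_{\bar1}\}$ normalized by $d\theta=i\theta^1\wedge\theta^{\bar1}$, let the connection form $\theta_1{}^1$ and the torsion $A_{\bar1\bar1}=\overline{A_{11}}$ be determined by $d\theta^1=\theta^1\wedge\theta_1{}^1+A_{\bar1\bar1}\,\theta\wedge\theta^{\bar1}$ and $\theta_1{}^1+\overline{\theta_1{}^1}=0$; indices denote components of covariant derivatives with respect to this connection (indices after a comma for the components of a tensor). Let $E^{0,1}=\langle\theta^{\bar1}\rangle$, $E^{1,0}=\langle\theta^1\rangle$,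 $F^{2,0}=\langle\theta^1\wedge\theta\rangle$ and $F^{2,1}=\langle\theta\wedge d\theta\rangle$ be the spaces of smooth complex forms that are locally multiples of the indicated forms, and put $$d''f=f_{\bar1}\theta^{\bar1},\qquad D^+(\sigma_{\bar1}\theta^{\bar1})=(i\sigma_{\bar1,11}-A_{11}\sigma_{\bar1})\,\theta^1\wedge\theta,\qquad d''(\sigma_1\theta^1\wedge\theta)=\sigma_{1,\bar1}\,\theta^{\bar1}\wedge\theta^1\wedge\theta\in F^{2,1},$$ $$P_3f=(f_{\bar111}+iA_{11}f_{\bar1})\,\theta^1,\qquad \delta_b(\sigma_1\theta^1)=\sigma_{1,\bar1},\qquad P_4f=\delta_b(P_3f).$$ Regard $P_3f\in E^{1,0}$ as an element of $F^{2,0}$ via $\sigma\mapsto\sigma\wedge\theta$. Then $P_3$ and $D^+d''$ are well-defined operators from $C^\infty(M;\mathbb C)$ to $F^{2,0}$, $P_3=-iD^+d''$, and the following hold. (1) Consider these operators on real-valued smooth functions. Let $\mathcal P$ be the space of CR pluriharmonic functions, i.e. of the smooth real-valued functions that are locally the real part of a CR holomorphic function (a function $F$ with $d''F=0$), and let $W$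 be a supplementary space, i.e. a real linear subspace of $C^\infty(M;\mathbb R)$ with $$\ker P_4=\mathcal P\oplus W.$$ Then $f\mapsto P_3f$ is an $\mathbb R$-linear isomorphism of $W$ onto $\ker d''\cap\operatorname{im}P_3\subset F^{2,0}$, and $f\mapsto D^+d''f$ is an $\mathbb R$-linear isomorphism of $W$ onto $\ker d''\cap\operatorname{im}D^+d''\subset F^{2,0}$. (2) Consider these operators on complex-valued smooth functions, and let $W\subset C^\infty(M;\mathbb C)$ be a complex linear subspace with $\ker P_4=\ker P_3\oplus W$. Then $f\mapsto P_3f$ is a $\mathbb C$-linear isomorphism of $W$ onto $\ker d''\cap\operatorname{im}P_3\subset F^{2,0}$, and also onto $\ker d''\cap\operatorname{im}D^+d''$. -/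

import Mathlib

open scoped Manifold ContDiff

noncomputable section

namespace CR

/-! ### Linear relations

The differential operators below are defined by formulas in local frames. An operator is recorded
by its graph, a linear subspace of the product of its source and its target. -/

section Relations

variable {k X Y Z : Type*} [Semiring k] [AddCommMonoid X] [Module k X]
  [AddCommMonoid Y] [Module k Y] [AddCommMonoid Z] [Module k Z]

/-- The kernel of the operator with graph `R`. -/
def relKer (R : Submodule k (X × Y)) : Submodule k X := R.comap (LinearMap.inl k X Y)

/-- The image of the operator with graph `R`. -/
def relIm (R : Submodule k (X × Y)) : Submodule k Y := R.map (LinearMap.snd k X Y)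

/-- The graph of "first `R`, then `Q`". -/
def relComp (R : Submodule k (X × Y)) (Q : Submodule k (Y × Z)) : Submodule k (X × Z) where
  carrier := {x | ∃ y, (x.1, y) ∈ R ∧ (y, x.2) ∈ Q}
  zero_mem' := ⟨0, R.zero_mem, Q.zero_mem⟩
  add_mem' := by
    rintro a b ⟨y, h1, h2⟩ ⟨z, h3, h4⟩
    exact ⟨y + z, R.add_mem h1 h3, Q.add_mem h2 h4⟩
  smul_mem' := by
    rintro c a ⟨y, h1, h2⟩
    exact ⟨c • y, R.smul_mem c h1, Q.smul_mem c h2⟩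

/-- The operator with graph `R` restricts to a linear isomorphism of `W` onto `K`. -/
def IsIsoOnto (R : Submodule k (X × Y)) (W : Submodule k X) (K : Submodule k Y) : Prop :=
  ∃ Φ : W ≃ₗ[k] K, ∀ f : W, ((f : X), (Φ f : Y)) ∈ R

/-- `K = P ⊕ W`. -/
def IsSupplementary (K P W : Submodule k X) : Prop := P ⊓ W = ⊥ ∧ P ⊔ W = K

end Relations

/-! ### Complex functions, vector fields and forms on a smooth three-manifold -/

section Manifold

variable (M : Type*) [TopologicalSpace M] [ChartedSpace (EuclideanSpace ℝ (Fin 3)) M]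

instance : ContMDiffRing 𝓘(ℝ, ℂ) ∞ ℂ :=
  { instNormedSpaceLieAddGroup with
    contMDiff_mul := by
      rw [contMDiff_iff]
      refine ⟨continuous_mul, fun x y => ?_⟩
      simp only [mfld_simps, chartAt_self_eq]
      rw [contDiffOn_univ]
      exact contDiff_mul }

/-- `C^∞(M; ℂ)`. -/
abbrev CF : Type _ := C^∞⟮𝓡 3, M; 𝓘(ℝ, ℂ), ℂ⟯

/-- The constant functions. -/
def constHom : ℂ →+* CF M where
  toFun c := ContMDiffMap.const c
  map_one' := rfl
  map_zero' := rfl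
  map_add' _ _ := rfl
  map_mul' _ _ := rfl

instance : Algebra ℂ (CF M) := (constHom M).toAlgebra

variable {M}

@[simp] theorem CF.smul_apply (c : ℂ) (f : CF M) (p : M) : (c • f) p = c * f p := rfl

@[simp] theorem CF.add_apply (f g : CF M) (p : M) : (f + g) p = f p + g p := rfl

@[simp] theorem CF.mul_apply (f g : CF M) (p : M) : (f * g) p = f p * g p := rfl

@[simp] theorem CF.sub_apply (f g : CF M) (p : M) : (f - g) p = f p - g p := by
  have h : f - g + g = f := sub_add_cancel f g
  have h2 := congrArg (fun u : CF M => u p) h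
  simp only [CF.add_apply] at h2
  exact eq_sub_of_add_eq h2

@[simp] theorem CF.zero_apply (p : M) : (0 : CF M) p = 0 := rfl

instance : IsScalarTower ℝ ℂ (CF M) where
  smul_assoc a c f := by
    ext p
    change (a • c) * f p = a • (c * f p)
    exact smul_mul_assoc a c (f p)

/-- Complex conjugation of functions. -/
def conjF : CF M →+* CF M where
  toFun f := ⟨fun p => (starRingEnd ℂ) (f p), Complex.conjCLE.contDiff.comp_contMDiff f.contMDiff⟩
  map_one' := by ext p; exact map_one (starRingEnd ℂ)
  map_zero' := by ext p; exact map_zero (starRingEnd ℂ)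
  map_add' f g := by ext p; exact map_add (starRingEnd ℂ) (f p) (g p)
  map_mul' f g := by ext p; exact map_mul (starRingEnd ℂ) (f p) (g p)

@[simp] theorem conjF_apply (f : CF M) (p : M) : conjF f p = (starRingEnd ℂ) (f p) := rfl

theorem conjF_conjF (f : CF M) : conjF (conjF f) = f := by
  ext p; exact Complex.conj_conj (f p)

theorem conjF_smul (c : ℂ) (f : CF M) : conjF (c • f) = (starRingEnd ℂ) c • conjF f := by
  ext p; exact map_mul (starRingEnd ℂ) c (f p)

variable (M) in
/-- Smooth sections of `TM ⊗ ℂ`, as derivations of `C^∞(M; ℂ)`; their Lie bracket is the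
commutator of derivations. -/
abbrev Vec : Type _ := Derivation ℂ (CF M) (CF M)

variable (M) in
/-- Smooth complex `1`-forms. -/
abbrev Form1 : Type _ := Vec M →ₗ[CF M] CF M

variable (M) in
/-- Smooth complex covariant `2`-tensors, among them the `2`-forms. -/
abbrev Form2 : Type _ := Vec M →ₗ[CF M] Vec M →ₗ[CF M] CF M

/-- The conjugate vector field. -/
def conjV (V : Vec M) : Vec M :=
  Derivation.mk'
    { toFun := fun f => conjF (V (conjF f))
      map_add' := fun f g => by simp only [map_add]
      map_smul' := fun c f => by
        simp only [conjF_smul, Derivation.map_smul, Complex.conj_conj, RingHom.id_apply] }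
    (fun f g => by
      change conjF (V (conjF (f * g))) = f • conjF (V (conjF g)) + g • conjF (V (conjF f))
      simp only [map_mul, Derivation.leibniz, smul_eq_mul, map_add, conjF_conjF])

theorem conjV_apply (V : Vec M) (f : CF M) : conjV V f = conjF (V (conjF f)) := rfl

/-- The conjugate form `V ↦ conj (α (conj V))`. -/
def conjForm (α : Form1 M) : Form1 M where
  toFun V := conjF (α (conjV V))
  map_add' V W := by
    have h : conjV (V + W) = conjV V + conjV W := by
      ext1 f; simp only [conjV_apply, Derivation.add_apply, map_add]
    rw [h, map_add, map_add]
  map_smul' b V := by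
    have h : conjV (b • V) = conjF b • conjV V := by
      ext1 f; simp only [conjV_apply, Derivation.smul_apply, smul_eq_mul, map_mul]
    rw [h, map_smul, smul_eq_mul, map_mul, conjF_conjF, RingHom.id_apply, smul_eq_mul]

/-- `(α ∧ β)(V, W) = α(V) β(W) - α(W) β(V)`. -/
def wedge (α β : Form1 M) : Form2 M := α.smulRight β - β.smulRight α

/-- The exterior derivative of a `1`-form. -/
def dForm (α : Form1 M) (V W : Vec M) : CF M := V (α W) - W (α V) - α ⁅V, W⁆

variable (M) in
/-- The real subspace of real-valued functions. -/
def realFunctions : Submodule ℝ (CF M) where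
  carrier := {f | ∀ p, (f p).im = 0}
  zero_mem' p := Complex.zero_im
  add_mem' {f g} hf hg p := by simp [hf p, hg p]
  smul_mem' c f hf p := by
    change (c • f p).im = 0
    simp [hf p]

/-! ### Pseudohermitian structures -/

variable (M) in
/-- A pseudohermitian structure `(J, θ)` on the three-manifold `M`. The complex structure on the
contact bundle `ξ = ker θ` is given by its complex linear extension to `ξ ⊗ ℂ`; that both `θ` and
`J` are real is expressed by compatibility with conjugation. -/
structure Pseudohermitian where
  /-- the contact form -/
  θ : Form1 M
  θ_real : conjForm θ = θ
  θ_ne_zero : ∀ p : M, ∃ V : Vec M, θ V p ≠ 0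
  /-- the complex structure on the contact bundle -/
  J : LinearMap.ker θ →ₗ[CF M] LinearMap.ker θ
  J_real : ∀ V W : LinearMap.ker θ, (W : Vec M) = conjV V → (J W : Vec M) = conjV (J V)
  J_sq : ∀ V, J (J V) = -V
  /-- the Levi form `-i dθ(Z, conj Z)` is positive on `T_{1,0}` -/
  levi_pos : ∀ V : LinearMap.ker θ, J V = algebraMap ℂ (CF M) Complex.I • V →
    ∀ p : M, (∃ g : CF M, (V : Vec M) g p ≠ 0) →
      0 < (-Complex.I * dForm θ V (conjV V) p).re

namespace Pseudohermitian

variable (S : Pseudohermitian M)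

/-- Sections of `T_{1,0}`, the `+i`-eigenspace of `J` in `ξ ⊗ ℂ`. -/
def T10 : Submodule (CF M) (Vec M) :=
  (LinearMap.ker (S.J - algebraMap ℂ (CF M) Complex.I • LinearMap.id)).map
    (LinearMap.ker S.θ).subtype

/-- A local frame `{T, Z_1, Z_{\bar 1}}` on an open set `U`, with `T` the Reeb field,
`Z_1` a section of `T_{1,0}` normalized by `h_{1\bar 1} = 1`, together with the dual form `θ^1`,
the connection form `conn = θ_1^1` and the torsion coefficient `A^1_{\bar 1}` determined by
`dθ^1 = θ^1 ∧ θ_1^1 + A^1_{\bar 1} θ ∧ θ^{\bar 1}` and `θ_1^1 + θ_{\bar 1}^{\bar 1} = 0`.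
All objects are global sections and all conditions are imposed on `U` only: after multiplication
by a bump function every local frame is, near any given point, of this kind. -/
structure LocalFrame where
  U : Set M
  isOpen : IsOpen U
  T : Vec M
  Z : Vec M
  θ1 : Form1 M
  conn : Form1 M
  torsion : CF M
  Z_mem : Z ∈ S.T10
  θ_T : ∀ p ∈ U, S.θ T p = 1
  dθ_T : ∀ p ∈ U, ∀ V, dForm S.θ T V p = 0
  θ1_T : ∀ p ∈ U, θ1 T p = 0
  θ1_Z : ∀ p ∈ U, θ1 Z p = 1
  θ1_Zbar : ∀ p ∈ U, θ1 (conjV Z) p = 0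
  levi : ∀ p ∈ U, ∀ V W, dForm S.θ V W p = Complex.I * wedge θ1 (conjForm θ1) V W p
  struct_eq : ∀ p ∈ U, ∀ V W, dForm θ1 V W p =
    wedge θ1 conn V W p + torsion p * wedge S.θ (conjForm θ1) V W p
  skew : ∀ p ∈ U, ∀ V, (conn V + conjForm conn V) p = 0

namespace LocalFrame

variable {S} (F : S.LocalFrame)

/-- `Z_{\bar 1}` -/
def Zbar : Vec M := conjV F.Z

/-- `A_{11}`, the conjugate of `A_{\bar 1\bar 1} = A^1_{\bar 1}` -/
def A11 : CF M := conjF F.torsion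

/-- The derivative in direction `V` of the component `c` of a tensor with `a` lower indices `1` and
`b` lower indices `\bar 1`: `V c - (a θ_1^1(V) + b θ_{\bar 1}^{\bar 1}(V)) c`. -/
def cov (a b : ℕ) (V : Vec M) (c : CF M) : CF M :=
  V c - (a • F.conn V + b • conjForm F.conn V) * c

/-- `σ_{1,\bar 1}` for the component `s = σ_1` -/
def c1bar (s : CF M) : CF M := F.cov 1 0 F.Zbar s

/-- `σ_{\bar 1,11}` for the component `s = σ_{\bar 1}` -/
def cbar11 (s : CF M) : CF M := F.cov 1 1 F.Z (F.cov 0 1 F.Z s)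

theorem cov_add (a b : ℕ) (V : Vec M) (c d : CF M) :
    F.cov a b V (c + d) = F.cov a b V c + F.cov a b V d := by
  simp only [cov, map_add]; ring

theorem cov_smul (a b : ℕ) (V : Vec M) (r : ℂ) (c : CF M) :
    F.cov a b V (r • c) = r • F.cov a b V c := by
  simp only [cov, Derivation.map_smul, mul_smul_comm, smul_sub]

theorem cov_zero (a b : ℕ) (V : Vec M) : F.cov a b V 0 = 0 := by
  simp [cov]

end LocalFrame

/-- `E^{1,0} = ⟨θ^1⟩` -/
def E10 : Submodule (CF M) (Form1 M) where
  carrier := {σ | ∀ F : S.LocalFrame, ∀ p ∈ F.U, ∀ V, σ V p = σ F.Z p * F.θ1 V p}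
  zero_mem' F p _ V := by simp
  add_mem' {σ τ} h1 h2 F p hp V := by
    simp only [LinearMap.add_apply, CF.add_apply, h1 F p hp V, h2 F p hp V, add_mul]
  smul_mem' c σ h F p hp V := by
    simp only [LinearMap.smul_apply, smul_eq_mul, CF.mul_apply, h F p hp V, mul_assoc]

/-- `E^{0,1} = ⟨θ^{\bar 1}⟩` -/
def E01 : Submodule (CF M) (Form1 M) where
  carrier := {σ | ∀ F : S.LocalFrame, ∀ p ∈ F.U, ∀ V,
    σ V p = σ F.Zbar p * conjForm F.θ1 V p}
  zero_mem' F p _ V := by simp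
  add_mem' {σ τ} h1 h2 F p hp V := by
    simp only [LinearMap.add_apply, CF.add_apply, h1 F p hp V, h2 F p hp V, add_mul]
  smul_mem' c σ h F p hp V := by
    simp only [LinearMap.smul_apply, smul_eq_mul, CF.mul_apply, h F p hp V, mul_assoc]

/-- `F^{2,0} = ⟨θ^1 ∧ θ⟩`; the coefficient of `θ^1 ∧ θ` in `η` is `η(Z_1, T)`. -/
def F20 : Submodule (CF M) (Form2 M) where
  carrier := {η | ∀ F : S.LocalFrame, ∀ p ∈ F.U, ∀ V W,
    η V W p = η F.Z F.T p * wedge F.θ1 S.θ V W p}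
  zero_mem' F p _ V W := by simp
  add_mem' {σ τ} h1 h2 F p hp V W := by
    simp only [LinearMap.add_apply, CF.add_apply, h1 F p hp V W, h2 F p hp V W, add_mul]
  smul_mem' c σ h F p hp V W := by
    simp only [LinearMap.smul_apply, smul_eq_mul, CF.mul_apply, h F p hp V W, mul_assoc]

/-- The graph of `d'' = \bar∂_b : E^{0,0} → E^{0,1}`, `f ↦ f_{\bar 1} θ^{\bar 1}`. -/
def dbar : Submodule ℂ (CF M × Form1 M) where
  carrier := {x | x.2 ∈ S.E01 ∧ ∀ F : S.LocalFrame, ∀ p ∈ F.U, x.2 F.Zbar p = F.Zbar x.1 p}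
  zero_mem' := ⟨S.E01.zero_mem, fun F p _ => by simp⟩
  add_mem' {x y} hx hy := ⟨S.E01.add_mem hx.1 hy.1, fun F p hp => by
    simp [hx.2 F p hp, hy.2 F p hp]⟩
  smul_mem' c x hx := ⟨S.E01.smul_of_tower_mem c hx.1, fun F p hp => by
    simp [hx.2 F p hp]⟩

/-- The graph of `D^+ : E^{0,1} → F^{2,0}`,
`σ_{\bar 1} θ^{\bar 1} ↦ (i σ_{\bar 1,11} - A_{11} σ_{\bar 1}) θ^1 ∧ θ`. -/
def Dplus : Submodule ℂ (Form1 M × Form2 M) where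
  carrier := {x | x.1 ∈ S.E01 ∧ x.2 ∈ S.F20 ∧ ∀ F : S.LocalFrame, ∀ p ∈ F.U,
    x.2 F.Z F.T p = (Complex.I • F.cbar11 (x.1 F.Zbar) - F.A11 * x.1 F.Zbar) p}
  zero_mem' := ⟨S.E01.zero_mem, S.F20.zero_mem, fun F p _ => by
    simp [LocalFrame.cbar11, LocalFrame.cov_zero]⟩
  add_mem' {x y} hx hy := ⟨S.E01.add_mem hx.1 hy.1, S.F20.add_mem hx.2.1 hy.2.1, fun F p hp => by
    simp only [Prod.snd_add, Prod.fst_add, LinearMap.add_apply, CF.add_apply, hx.2.2 F p hp,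
      hy.2.2 F p hp, LocalFrame.cbar11, LocalFrame.cov_add, CF.sub_apply, CF.smul_apply,
      CF.mul_apply]
    ring⟩
  smul_mem' c x hx := ⟨S.E01.smul_of_tower_mem c hx.1, S.F20.smul_of_tower_mem c hx.2.1,
    fun F p hp => by
      simp only [Prod.smul_snd, Prod.smul_fst, LinearMap.smul_apply, hx.2.2 F p hp,
        LocalFrame.cbar11, LocalFrame.cov_smul, CF.sub_apply, CF.smul_apply, CF.mul_apply]
      ring⟩

/-- The graph of `d'' : F^{2,0} → F^{2,1}`,
`σ_1 θ^1 ∧ θ ↦ σ_{1,\bar 1} θ^{\bar 1} ∧ θ^1 ∧ θ = i σ_{1,\bar 1} θ ∧ dθ`. The bundle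
`F^{2,1} = ⟨θ ∧ dθ⟩` is identified with the trivial one via the coefficient of `θ ∧ dθ`. -/
def dbarF20 : Submodule ℂ (Form2 M × CF M) where
  carrier := {x | x.1 ∈ S.F20 ∧ ∀ F : S.LocalFrame, ∀ p ∈ F.U,
    x.2 p = (Complex.I • F.c1bar (x.1 F.Z F.T)) p}
  zero_mem' := ⟨S.F20.zero_mem, fun F p _ => by
    simp [LocalFrame.c1bar, LocalFrame.cov_zero]⟩
  add_mem' {x y} hx hy := ⟨S.F20.add_mem hx.1 hy.1, fun F p hp => by
    simp only [Prod.snd_add, Prod.fst_add, LinearMap.add_apply, CF.add_apply, hx.2 F p hp,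
      hy.2 F p hp, LocalFrame.c1bar, LocalFrame.cov_add, CF.smul_apply]
    ring⟩
  smul_mem' c x hx := ⟨S.F20.smul_of_tower_mem c hx.1, fun F p hp => by
    simp only [Prod.smul_snd, Prod.smul_fst, LinearMap.smul_apply, hx.2 F p hp,
      LocalFrame.c1bar, LocalFrame.cov_smul, CF.smul_apply]
    ring⟩

/-- The graph of `P_3 : E^{0,0} → E^{1,0}`,
`f ↦ (f_{\bar 1}{}^{\bar 1}{}_1 + i A_{11} f^1) θ^1`; as `h_{1\bar 1} = 1`, the coefficient is
`f_{\bar 1 1 1} + i A_{11} f_{\bar 1}`. -/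
def P3 : Submodule ℂ (CF M × Form1 M) where
  carrier := {x | x.2 ∈ S.E10 ∧ ∀ F : S.LocalFrame, ∀ p ∈ F.U,
    x.2 F.Z p = (F.cbar11 (F.Zbar x.1) + Complex.I • (F.A11 * F.Zbar x.1)) p}
  zero_mem' := ⟨S.E10.zero_mem, fun F p _ => by
    simp [LocalFrame.cbar11, LocalFrame.cov_zero]⟩
  add_mem' {x y} hx hy := ⟨S.E10.add_mem hx.1 hy.1, fun F p hp => by
    simp only [Prod.snd_add, Prod.fst_add, LinearMap.add_apply, CF.add_apply, hx.2 F p hp,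
      hy.2 F p hp, LocalFrame.cbar11, LocalFrame.cov_add, CF.smul_apply, map_add,
      CF.mul_apply]
    ring⟩
  smul_mem' c x hx := ⟨S.E10.smul_of_tower_mem c hx.1, fun F p hp => by
    simp only [Prod.smul_snd, Prod.smul_fst, LinearMap.smul_apply, hx.2 F p hp, CF.add_apply,
      LocalFrame.cbar11, LocalFrame.cov_smul, CF.smul_apply, CF.mul_apply, Derivation.map_smul]
    ring⟩

/-- The graph of the divergence `δ_b : E^{1,0} → E^{0,0}`, `σ_1 θ^1 ↦ σ_{1,}{}^1`; as
`h_{1\bar 1} = 1`, this is `σ_{1,\bar 1}`. -/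
def divergence : Submodule ℂ (Form1 M × CF M) where
  carrier := {x | x.1 ∈ S.E10 ∧ ∀ F : S.LocalFrame, ∀ p ∈ F.U, x.2 p = F.c1bar (x.1 F.Z) p}
  zero_mem' := ⟨S.E10.zero_mem, fun F p _ => by
    simp [LocalFrame.c1bar, LocalFrame.cov_zero]⟩
  add_mem' {x y} hx hy := ⟨S.E10.add_mem hx.1 hy.1, fun F p hp => by
    simp only [Prod.snd_add, Prod.fst_add, LinearMap.add_apply, CF.add_apply, hx.2 F p hp,
      hy.2 F p hp, LocalFrame.c1bar, LocalFrame.cov_add]⟩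
  smul_mem' c x hx := ⟨S.E10.smul_of_tower_mem c hx.1, fun F p hp => by
    simp only [Prod.smul_snd, Prod.smul_fst, LinearMap.smul_apply, hx.2 F p hp,
      LocalFrame.c1bar, LocalFrame.cov_smul, CF.smul_apply]⟩

/-- The CR Paneitz operator `P_4 = δ_b P_3`. -/
def P4 : Submodule ℂ (CF M × CF M) := relComp S.P3 S.divergence

/-- The identification `E^{1,0} ≅ F^{2,0}`, `σ ↦ σ ∧ θ`. -/
def wedgeθ : Form1 M →ₗ[ℂ] Form2 M where
  toFun σ := wedge σ S.θ
  map_add' σ τ := by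
    ext V W p; simp [wedge]; ring
  map_smul' c σ := by
    ext V W p; simp [wedge]; ring

/-- `P_3`, with values in `F^{2,0}`. -/
def P3F20 : Submodule ℂ (CF M × Form2 M) := relComp S.P3 S.wedgeθ.graph

/-- `D^+ d'' : E^{0,0} → F^{2,0}`. -/
def DplusDbar : Submodule ℂ (CF M × Form2 M) := relComp S.dbar S.Dplus

/-- `F` is a CR holomorphic function on `U`. -/
def IsCROn (F : CF M) (U : Set M) : Prop := ∀ Z ∈ S.T10, ∀ p ∈ U, conjV Z F p = 0

/-- The (real) space of CR pluriharmonic functions: the smooth real-valued functions that are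
locally the real part of a CR holomorphic function. -/
def pluriharmonic : Submodule ℝ (CF M) where
  carrier := {f | ∀ p : M, ∃ U : Set M, IsOpen U ∧ p ∈ U ∧
    ∃ F : CF M, S.IsCROn F U ∧ ∀ q ∈ U, f q = ((F q).re : ℂ)}
  zero_mem' p := ⟨Set.univ, isOpen_univ, trivial, 0, fun Z _ q _ => by simp, fun q _ => by simp⟩
  add_mem' {f g} hf hg p := by
    obtain ⟨U, hU, hpU, F, hF, hfF⟩ := hf p
    obtain ⟨V, hV, hpV, G, hG, hgG⟩ := hg p
    refine ⟨U ∩ V, hU.inter hV, ⟨hpU, hpV⟩, F + G, fun Z hZ q hq => ?_, fun q hq => ?_⟩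
    · simp [hF Z hZ q hq.1, hG Z hZ q hq.2]
    · simp [hfF q hq.1, hgG q hq.2]
  smul_mem' c f hf p := by
    obtain ⟨U, hU, hpU, F, hF, hfF⟩ := hf p
    refine ⟨U, hU, hpU, (c : ℂ) • F, fun Z hZ q hq => ?_, fun q hq => ?_⟩
    · simp [hF Z hZ q hq]
    · change c • f q = (((c : ℂ) * F q).re : ℂ)
      simp [hfF q hq]

end Pseudohermitian

/-- The restriction to real-valued functions of the operator with graph `R`. -/
def onReal {Y : Type*} [AddCommMonoid Y] [Module ℝ Y] [Module ℂ Y] [IsScalarTower ℝ ℂ Y]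
    (R : Submodule ℂ (CF M × Y)) : Submodule ℝ (CF M × Y) :=
  R.restrictScalars ℝ ⊓ (realFunctions M).prod ⊤

end Manifold

end CR

end

open scoped Manifold ContDiff

noncomputable section

namespace CR

open Topology Filter

/-! The isomorphisms are linear algebra once two kernels are known. Under `σ ↦ σ ∧ θ` the divergence
and `d''` on `F^{2,0}` have the same coefficient up to the factor `i`, so `P_4 f = 0` exactly when
`P_3 f` is `d''`-closed (`mem_relKer_P4_iff`). Hence `P_3` maps `ker P_4` onto `ker d'' ∩ im P_3`,
and a complement of its kernel is carried isomorphically (`IsSupplementary.isIsoOnto`). The operator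
`D^+ d''` is `i P_3`, so it behaves in the same way.

The analytic content is that a real `f` satisfies `P_3 f = 0` iff it is CR pluriharmonic. If `f = Re
H` with `H` CR, then `f_{\bar 1}` is half of `h_{\bar 1}` for the anti-CR function `h = conj H`, and
the commutation rules with `h_1 = 0` give `P_3 h = 0` (`coeff_eq_zero_of_anti`). Conversely, the
real form `α = i (f_{\bar 1} θ^{\bar 1} - f_1 θ^1) + l θ` with `l = -(f_{\bar 1 1} + f_{1 \bar 1})`
satisfies `dα(Z_1, Z_{\bar 1}) = 0`, while `dα(T, Z_1)` is twice the coefficient of `P_3 f`. So `P_3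
f = 0` makes `α` closed, and a real local primitive `g` makes `f + i g` CR
(`pluriharmonic_of_coeff_eq_zero`).

That the operators are everywhere defined and single-valued rests on the existence of local frames
(`exists_localFrame`) and on a change of frame `Z_1' = u Z_1`, `|u| = 1`, multiplying the
coefficient of `P_3 f` by `u` and `θ^1` by `conj u` (`coeff_change`, `θ1_change`). Vector fields are
derivations and forms are linear maps on them, so their pointwise nature is derived from Hadamard's
lemma in charts. -/

/-! ### Calculus: parameter integrals and Hadamard's lemma -/

/-- Integration over `[0, 1]` preserves smooth dependence on parameters. -/
theorem contDiff_integral_unitInterval {E F : Type*} [NormedAddCommGroup E] [NormedSpace ℝ E]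
    [NormedAddCommGroup F] [NormedSpace ℝ F] {G : E → ℝ → F}
    (hG : ContDiff ℝ ∞ (Function.uncurry G)) :
    ContDiff ℝ ∞ (fun y => ∫ t in (0 : ℝ)..1, G y t) := by
  -- The integral is the value at `0` of the convolution of the indicator of `(0, 1]` with `s ↦ ψ s
  -- • G y (-s)`. The cutoff `ψ` is `1` where the indicator lives and supplies the compact support
  -- needed for smoothness of a convolution with parameters.
  let ψ : ContDiffBump (0 : ℝ) := ⟨1, 2, one_pos, one_lt_two⟩
  have hf : MeasureTheory.LocallyIntegrable (Set.indicator (Set.Ioc (0 : ℝ) 1) fun _ => (1 : ℝ))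
      MeasureTheory.volume := by
    refine MeasureTheory.Integrable.locallyIntegrable ?_
    refine (MeasureTheory.integrable_indicator_iff measurableSet_Ioc).2 ?_
    exact (MeasureTheory.integrableOn_const (by simp) (by simp))
  have hg : ContDiff ℝ ∞ (Function.uncurry fun (y : E) (s : ℝ) => ψ s • G y (-s)) := by
    have h1 : ContDiff ℝ ∞ fun x : E × ℝ => ψ x.2 := ψ.contDiff.comp contDiff_snd
    have h2 : ContDiff ℝ ∞ fun x : E × ℝ => G x.1 (-x.2) :=
      hG.comp (contDiff_fst.prodMk contDiff_snd.neg)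
    exact h1.smul h2
  have key := MeasureTheory.contDiffOn_convolution_right_with_param_comp (𝕜 := ℝ) (n := ⊤)
    (μ := MeasureTheory.volume) (ContinuousLinearMap.lsmul ℝ ℝ : ℝ →L[ℝ] F →L[ℝ] F)
    (s := (Set.univ : Set E)) (v := fun _ => (0 : ℝ)) contDiffOn_const
    (g := fun y s => ψ s • G y (-s)) (k := Metric.closedBall 0 2) isOpen_univ
    (isCompact_closedBall 0 2) (fun y s _ hs => by
      have : ψ s = 0 := ψ.zero_of_le_dist (by
        simp only [Metric.mem_closedBall, not_le] at hs
        exact hs.le)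
      simp [this]) hf hg.contDiffOn
  rw [contDiffOn_univ] at key
  convert key using 2 with y
  rw [MeasureTheory.convolution, intervalIntegral.integral_of_le zero_le_one,
    ← MeasureTheory.integral_indicator measurableSet_Ioc]
  congr 1
  ext t
  by_cases ht : t ∈ Set.Ioc (0 : ℝ) 1
  · have : ψ (-t) = 1 := ψ.one_of_mem_closedBall (by
      simp only [Metric.mem_closedBall, dist_zero_right, norm_neg, Real.norm_eq_abs]
      rw [abs_of_pos ht.1]
      exact ht.2)
    simp [ht, this]
  · simp [ht]

/-- Hadamard's lemma. -/
theorem exists_contDiff_eq_add_apply_sub {E F : Type*} [NormedAddCommGroup E] [NormedSpace ℝ E]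
    [NormedAddCommGroup F] [NormedSpace ℝ F] [CompleteSpace F] {h : E → F}
    (hh : ContDiff ℝ ∞ h) (a : E) :
    ∃ g : E → E →L[ℝ] F, ContDiff ℝ ∞ g ∧ g a = fderiv ℝ h a ∧
      ∀ y, h y = h a + g y (y - a) := by
  have hd : ContDiff ℝ ∞ (fderiv ℝ h) := hh.fderiv_right (by simp)
  have hG : ContDiff ℝ ∞ (Function.uncurry fun (y : E) (t : ℝ) => fderiv ℝ h (a + t • (y - a))) := by
    refine hd.comp ?_
    fun_prop
  -- `g y` is the average of the derivative of `h` over the segment from `a` to `y`.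
  refine ⟨fun y => ∫ t in (0 : ℝ)..1, fderiv ℝ h (a + t • (y - a)),
    contDiff_integral_unitInterval hG, by simp, fun y => ?_⟩
  have hc : Continuous fun t : ℝ => fderiv ℝ h (a + t • (y - a)) :=
    hG.continuous.comp (Continuous.prodMk_right y)
  have hder : ∀ t : ℝ, HasDerivAt (fun t : ℝ => h (a + t • (y - a)))
      (fderiv ℝ h (a + t • (y - a)) (y - a)) t := fun t => by
    have h1 : HasDerivAt (fun t : ℝ => a + t • (y - a)) (y - a) t := by
      simpa using ((hasDerivAt_id t).smul_const (y - a)).const_add a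
    exact ((hh.differentiable (by simp)).differentiableAt.hasFDerivAt
      (x := a + t • (y - a))).comp_hasDerivAt t h1
  have := intervalIntegral.integral_eq_sub_of_hasDerivAt (a := 0) (b := 1) (fun t _ => hder t)
    ((hc.clm_apply continuous_const).intervalIntegrable 0 1)
  rw [ContinuousLinearMap.intervalIntegral_apply (hc.intervalIntegrable 0 1), this]
  simp

/-! ### Germs, bump functions and locality of derivations -/

section Locality

variable {M : Type*} [TopologicalSpace M] [T2Space M]
  [ChartedSpace (EuclideanSpace ℝ (Fin 3)) M] [IsManifold (𝓡 3) ∞ M]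

/-- Every germ of a smooth function is the germ of a global smooth function. -/
theorem exists_eventually_eq_of_contMDiffOn {f : M → ℂ} {p : M} {W : Set M} (hW : W ∈ 𝓝 p)
    (hf : ContMDiffOn (𝓡 3) 𝓘(ℝ, ℂ) ∞ f W) : ∃ g : CF M, ∀ᶠ q in 𝓝 p, g q = f q := by
  obtain ⟨W', hW'W, hW'o, hpW'⟩ := mem_nhds_iff.1 hW
  obtain ⟨b, -, hb⟩ := (SmoothBumpFunction.nhds_basis_tsupport (I := 𝓡 3) p).mem_iff.1
    (hW'o.mem_nhds hpW')
  refine ⟨⟨fun q => b q • f q, contMDiff_of_tsupport fun q hq => ?_⟩, ?_⟩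
  · have hqW : q ∈ W' := hb (tsupport_smul_subset_left _ _ hq)
    exact b.contMDiffAt.smul ((hf.mono hW'W).contMDiffAt (hW'o.mem_nhds hqW))
  · filter_upwards [b.eventuallyEq_one] with q hq
    change b q • f q = f q
    rw [hq]
    exact one_smul ℝ (f q)

/-- Smooth bump functions. -/
theorem exists_bump {p : M} {W : Set M} (hW : W ∈ 𝓝 p) :
    ∃ χ : CF M, (∀ᶠ q in 𝓝 p, χ q = 1) ∧ ∀ q ∉ W, χ q = 0 := by
  obtain ⟨b, -, hb⟩ := (SmoothBumpFunction.nhds_basis_tsupport (I := 𝓡 3) p).mem_iff.1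
    hW
  refine ⟨⟨fun q => (b q : ℂ), Complex.ofRealCLM.contDiff.comp_contMDiff b.contMDiff⟩, ?_, ?_⟩
  · filter_upwards [b.eventuallyEq_one] with q hq
    change (b q : ℂ) = 1
    rw [hq]
    simp
  · intro q hq
    change (b q : ℂ) = 0
    have : b q = 0 := image_eq_zero_of_notMem_tsupport fun h => hq (hb h)
    rw [this, Complex.ofReal_zero]

/-- Derivations are local operators. -/
theorem Vec.congr_of_eventually_eq (V : Vec M) {f g : CF M} {p : M}
    (h : ∀ᶠ q in 𝓝 p, f q = g q) : V f p = V g p := by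
  obtain ⟨χ, hχ1, hχ0⟩ := exists_bump h
  -- By the Leibniz rule at `p`, where `χ = 1` and `f = g`, applying `V` to this zero function
  -- leaves `V f p - V g p`.
  have h0 : χ * (f - g) = 0 := by
    ext q
    by_cases hq : f q = g q
    · simp [hq]
    · simp [hχ0 q hq]
  have h1 : V (χ * (f - g)) p = 0 := by rw [h0, map_zero]; rfl
  have hp : f p = g p := h.self_of_nhds
  rw [Derivation.leibniz, map_sub] at h1
  simp only [smul_eq_mul, CF.add_apply, CF.mul_apply, CF.sub_apply, hχ1.self_of_nhds, hp] at h1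
  linear_combination h1

theorem Vec.congr_on (V : Vec M) {f g : CF M} {U : Set M} (hU : IsOpen U)
    (h : ∀ q ∈ U, f q = g q) {p : M} (hp : p ∈ U) : V f p = V g p :=
  V.congr_of_eventually_eq (Filter.eventually_of_mem (hU.mem_nhds hp) h)

end Locality

@[simp] theorem CF.neg_apply {M : Type*} [TopologicalSpace M]
    [ChartedSpace (EuclideanSpace ℝ (Fin 3)) M] (f : CF M) (p : M) : (-f) p = -f p := rfl

@[simp] theorem CF.algebraMap_apply {M : Type*} [TopologicalSpace M]
    [ChartedSpace (EuclideanSpace ℝ (Fin 3)) M] (c : ℂ) (p : M) :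
    (algebraMap ℂ (CF M) c) p = c := rfl

@[simp] theorem CF.sum_apply {M : Type*} [TopologicalSpace M]
    [ChartedSpace (EuclideanSpace ℝ (Fin 3)) M] {ι : Type*} (s : Finset ι) (f : ι → CF M) (p : M) :
    (∑ i ∈ s, f i) p = ∑ i ∈ s, f i p := by
  classical
  induction s using Finset.induction_on with
  | empty => simp
  | insert a s ha ih => simp [Finset.sum_insert ha, ih]

/-! ### Coordinate vector fields and the Poincaré lemma in a chart -/

section ChartFrame

variable {M : Type*} [TopologicalSpace M] [ChartedSpace (EuclideanSpace ℝ (Fin 3)) M]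

/-- A frame of coordinate vector fields `X i` with coordinate functions `x i` near `p`. The last
field is the Poincaré lemma for `1`-forms. -/
structure ChartFrame (p : M) where
  U : Set M
  isOpen : IsOpen U
  mem : p ∈ U
  x : Fin 3 → CF M
  X : Fin 3 → Vec M
  X_x : ∀ q ∈ U, ∀ i j, X i (x j) q = if i = j then 1 else 0
  expand : ∀ q ∈ U, ∀ (V : Vec M) (f : CF M), V f q = ∑ i, V (x i) q * X i f q
  primitive : ∀ a : Fin 3 → CF M, (∀ᶠ q in 𝓝 p, ∀ i j, X i (a j) q = X j (a i) q) →
    ∃ G : CF M, ∀ᶠ q in 𝓝 p, ∀ i, X i G q = a i q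

/-- The derivative of `f` at `q` in the coordinate direction `v` of the chart at `p`. -/
def chartDeriv (p : M) (v : EuclideanSpace ℝ (Fin 3)) (f : CF M) (q : M) : ℂ :=
  fderiv ℝ (f ∘ (extChartAt (𝓡 3) p).symm) (extChartAt (𝓡 3) p q) v

theorem chartDeriv_congr {p q : M} (v : EuclideanSpace ℝ (Fin 3)) {f : CF M}
    {h : EuclideanSpace ℝ (Fin 3) → ℂ} (hq : q ∈ (extChartAt (𝓡 3) p).source)
    (hf : ∀ᶠ q' in 𝓝 q, f q' = h (extChartAt (𝓡 3) p q')) :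
    chartDeriv p v f q = fderiv ℝ h (extChartAt (𝓡 3) p q) v := by
  have h1 : ∀ᶠ y in 𝓝 (extChartAt (𝓡 3) p q), (f ∘ (extChartAt (𝓡 3) p).symm) y = h y := by
    have hc : Tendsto (extChartAt (𝓡 3) p).symm (𝓝 (extChartAt (𝓡 3) p q)) (𝓝 q) := by
      have := continuousAt_extChartAt_symm'' (I := 𝓡 3) ((extChartAt (𝓡 3) p).map_source hq)
      rwa [ContinuousAt, (extChartAt (𝓡 3) p).left_inv hq] at this
    filter_upwards [hc.eventually hf, (isOpen_extChartAt_target (I := 𝓡 3) p).mem_nhds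
      ((extChartAt (𝓡 3) p).map_source hq)] with y hy hyt
    rw [Function.comp_apply, hy, (extChartAt (𝓡 3) p).right_inv hyt]
  rw [chartDeriv, Filter.EventuallyEq.fderiv_eq h1]

theorem eventually_of_eventually_nhds_symm {p : M} {P : M → Prop} (h : ∀ᶠ q in 𝓝 p, P q) :
    ∀ᶠ y in 𝓝 (extChartAt (𝓡 3) p p), P ((extChartAt (𝓡 3) p).symm y) := by
  have := continuousAt_extChartAt_symm (I := 𝓡 3) p
  rw [ContinuousAt, extChartAt_to_inv] at this
  exact this.eventually h

variable [IsManifold (𝓡 3) ∞ M]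

theorem CF.contDiffOn_comp_extChartAt_symm (f : CF M) (p : M) :
    ContDiffOn ℝ ∞ (f ∘ (extChartAt (𝓡 3) p).symm) (extChartAt (𝓡 3) p).target :=
  (f.contMDiff.comp_contMDiffOn (contMDiffOn_extChartAt_symm p)).contDiffOn

theorem CF.contDiffAt_comp_extChartAt_symm (f : CF M) {p q : M}
    (hq : q ∈ (extChartAt (𝓡 3) p).source) :
    ContDiffAt ℝ ∞ (f ∘ (extChartAt (𝓡 3) p).symm) (extChartAt (𝓡 3) p q) :=
  (f.contDiffOn_comp_extChartAt_symm p).contDiffAt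
    ((isOpen_extChartAt_target p).mem_nhds ((extChartAt (𝓡 3) p).map_source hq))

theorem CF.differentiableAt_comp_extChartAt_symm (f : CF M) {p q : M}
    (hq : q ∈ (extChartAt (𝓡 3) p).source) :
    DifferentiableAt ℝ (f ∘ (extChartAt (𝓡 3) p).symm) (extChartAt (𝓡 3) p q) :=
  (f.contDiffAt_comp_extChartAt_symm hq).differentiableAt (by simp)

theorem contMDiffOn_comp_extChartAt {F : Type*} [NormedAddCommGroup F] [NormedSpace ℝ F]
    {h : EuclideanSpace ℝ (Fin 3) → F} {p : M} {s : Set (EuclideanSpace ℝ (Fin 3))}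
    (hh : ContDiffOn ℝ ∞ h s) :
    ContMDiffOn (𝓡 3) 𝓘(ℝ, F) ∞ (fun q => h (extChartAt (𝓡 3) p q))
      ((extChartAt (𝓡 3) p).source ∩ extChartAt (𝓡 3) p ⁻¹' s) := by
  refine hh.contMDiffOn.comp (t := s) ((contMDiffOn_extChartAt (x := p)).mono ?_) ?_
  · rw [extChartAt_source]
    exact Set.inter_subset_left
  · exact Set.inter_subset_right

theorem contMDiffOn_chartDeriv (p : M) (v : EuclideanSpace ℝ (Fin 3)) (f : CF M) :
    ContMDiffOn (𝓡 3) 𝓘(ℝ, ℂ) ∞ (chartDeriv p v f) (extChartAt (𝓡 3) p).source := by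
  have h : ContDiffOn ℝ ∞ (fun y => fderiv ℝ (f ∘ (extChartAt (𝓡 3) p).symm) y v)
      (extChartAt (𝓡 3) p).target :=
    ((f.contDiffOn_comp_extChartAt_symm p).fderiv_of_isOpen (isOpen_extChartAt_target p)
      (by simp)).clm_apply contDiffOn_const
  refine (contMDiffOn_comp_extChartAt (p := p) h).mono fun q hq => ?_
  exact ⟨hq, (extChartAt (𝓡 3) p).map_source hq⟩

theorem chartDeriv_add {p q : M} (v : EuclideanSpace ℝ (Fin 3)) (f g : CF M)
    (hq : q ∈ (extChartAt (𝓡 3) p).source) :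
    chartDeriv p v (f + g) q = chartDeriv p v f q + chartDeriv p v g q := by
  have : ((f + g : CF M) : M → ℂ) ∘ (extChartAt (𝓡 3) p).symm =
    f ∘ (extChartAt (𝓡 3) p).symm + g ∘ (extChartAt (𝓡 3) p).symm := rfl
  rw [chartDeriv, this, fderiv_add (f.differentiableAt_comp_extChartAt_symm hq)
    (g.differentiableAt_comp_extChartAt_symm hq)]
  rfl

theorem chartDeriv_mul {p q : M} (v : EuclideanSpace ℝ (Fin 3)) (f g : CF M)
    (hq : q ∈ (extChartAt (𝓡 3) p).source) :
    chartDeriv p v (f * g) q = f q * chartDeriv p v g q + g q * chartDeriv p v f q := by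
  have : ((f * g : CF M) : M → ℂ) ∘ (extChartAt (𝓡 3) p).symm =
    (f ∘ (extChartAt (𝓡 3) p).symm) * (g ∘ (extChartAt (𝓡 3) p).symm) := rfl
  rw [chartDeriv, this, fderiv_mul (f.differentiableAt_comp_extChartAt_symm hq)
    (g.differentiableAt_comp_extChartAt_symm hq)]
  simp only [_root_.add_apply, _root_.smul_apply, Function.comp_apply,
    (extChartAt (𝓡 3) p).left_inv hq, smul_eq_mul, chartDeriv]

theorem chartDeriv_smul {p q : M} (v : EuclideanSpace ℝ (Fin 3)) (c : ℂ) (f : CF M)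
    (hq : q ∈ (extChartAt (𝓡 3) p).source) :
    chartDeriv p v (c • f) q = c * chartDeriv p v f q := by
  have h : chartDeriv p v (algebraMap ℂ (CF M) c) q = 0 := by
    rw [chartDeriv_congr v (h := fun _ => c) hq (Eventually.of_forall fun _ => rfl)]
    simp
  rw [Algebra.smul_def, chartDeriv_mul v _ _ hq, h]
  simp

variable [T2Space M]

/-- The coordinate vector field `v` of the chart at `p`, cut off outside of the chart. -/
def chartVec {p : M} (b : SmoothBumpFunction (𝓡 3) p) (v : EuclideanSpace ℝ (Fin 3)) : Vec M :=
  Derivation.mk'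
    { toFun := fun f => ⟨fun q => b q • chartDeriv p v f q, b.contMDiff_smul (by
        rw [← extChartAt_source (𝓡 3)]
        exact contMDiffOn_chartDeriv p v f)⟩
      map_add' := fun f g => by
        ext q
        change b q • chartDeriv p v (f + g) q = b q • chartDeriv p v f q + b q • chartDeriv p v g q
        by_cases hq : q ∈ (extChartAt (𝓡 3) p).source
        · rw [chartDeriv_add v f g hq, smul_add]
        · simp [image_eq_zero_of_notMem_tsupport
            fun h => hq (b.tsupport_subset_extChartAt_source h)]
      map_smul' := fun c f => by
        ext q
        change b q • chartDeriv p v (c • f) q = c * (b q • chartDeriv p v f q)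
        by_cases hq : q ∈ (extChartAt (𝓡 3) p).source
        · rw [chartDeriv_smul v c f hq, mul_smul_comm]
        · simp [image_eq_zero_of_notMem_tsupport
            fun h => hq (b.tsupport_subset_extChartAt_source h)] }
    (fun f g => by
      ext q
      change b q • chartDeriv p v (f * g) q =
        f q * (b q • chartDeriv p v g q) + g q * (b q • chartDeriv p v f q)
      by_cases hq : q ∈ (extChartAt (𝓡 3) p).source
      · rw [chartDeriv_mul v f g hq, mul_smul_comm, mul_smul_comm, smul_add]
      · simp [image_eq_zero_of_notMem_tsupport
          fun h => hq (b.tsupport_subset_extChartAt_source h)])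

theorem chartVec_apply {p : M} (b : SmoothBumpFunction (𝓡 3) p) (v : EuclideanSpace ℝ (Fin 3))
    (f : CF M) (q : M) : chartVec b v f q = b q • chartDeriv p v f q := rfl

/-- The `i`-th coordinate function of the chart at `p`, cut off outside of the chart. -/
def chartCoord {p : M} (b : SmoothBumpFunction (𝓡 3) p) (i : Fin 3) : CF M :=
  ⟨fun q => b q • ((extChartAt (𝓡 3) p q i : ℝ) : ℂ), b.contMDiff_smul (by
    rw [← extChartAt_source (𝓡 3)]
    have h : ContDiffOn ℝ ∞ (fun y : EuclideanSpace ℝ (Fin 3) => ((y i : ℝ) : ℂ)) Set.univ :=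
      (Complex.ofRealCLM.contDiff.comp (EuclideanSpace.proj i).contDiff).contDiffOn
    simpa using contMDiffOn_comp_extChartAt (p := p) h)⟩

theorem chartCoord_apply {p : M} (b : SmoothBumpFunction (𝓡 3) p) (i : Fin 3) (q : M) :
    chartCoord b i q = b q • ((extChartAt (𝓡 3) p q i : ℝ) : ℂ) := rfl

/-- Hadamard's lemma writes `f` near `q` as a constant plus `∑ (x_i - x_i(q)) G_i` with `G_i(q) =
∂_i f(q)`. A derivation kills constants, and the Leibniz rule at `q` leaves `∑ V(x_i)(q) G_i(q)`. -/
theorem chartVec_expand {p : M} (b : SmoothBumpFunction (𝓡 3) p) {q : M}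
    (hq : q ∈ (extChartAt (𝓡 3) p).source) (hb : ∀ᶠ q' in 𝓝 q, b q' = 1) (V : Vec M) (f : CF M) :
    V f q = ∑ i, V (chartCoord b i) q * chartVec b (EuclideanSpace.single i 1) f q := by
  set φ := extChartAt (𝓡 3) p with hφ
  have hφq : ∀ᶠ q' in 𝓝 q, q' ∈ φ.source := (isOpen_extChartAt_source p).mem_nhds hq
  have hφc : Tendsto φ (𝓝 q) (𝓝 (φ q)) := continuousAt_extChartAt' hq
  -- The coordinate expression of `f` is smooth only on the chart target; `h` is a globally smooth
  -- function with the same germ, as Hadamard's lemma requires.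
  obtain ⟨h, hh⟩ := exists_eventually_eq_of_contMDiffOn (M := EuclideanSpace ℝ (Fin 3))
    ((isOpen_extChartAt_target p).mem_nhds (φ.map_source hq))
    (f.contDiffOn_comp_extChartAt_symm p).contMDiffOn
  obtain ⟨g, hg, hga, hgy⟩ := exists_contDiff_eq_add_apply_sub h.contMDiff.contDiff (φ q)
  have hG : ∀ i : Fin 3, ∃ G : CF M, ∀ᶠ q' in 𝓝 q,
      G q' = g (φ q') (EuclideanSpace.single i 1) := fun i => by
    refine exists_eventually_eq_of_contMDiffOn hφq ?_
    have h1 : ContDiffOn ℝ ∞ (fun y => g y (EuclideanSpace.single i 1)) Set.univ :=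
      (hg.clm_apply contDiff_const).contDiffOn
    have h2 := contMDiffOn_comp_extChartAt (p := p) h1
    rwa [Set.preimage_univ, Set.inter_univ] at h2
  choose G hG using hG
  have hfh : ∀ᶠ q' in 𝓝 q, f q' = h (φ q') := by
    filter_upwards [hφc.eventually hh, hφq] with q' h1 h2
    rw [h1, Function.comp_apply, φ.left_inv h2]
  have hf : ∀ᶠ q' in 𝓝 q, f q' = (algebraMap ℂ (CF M) (h (φ q)) +
      ∑ i, (chartCoord b i - algebraMap ℂ (CF M) ((φ q i : ℝ) : ℂ)) * G i) q' := by
    filter_upwards [hfh, hb, eventually_all.2 hG] with q' h1 h2 h3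
    rw [h1, hgy]
    simp only [CF.add_apply, CF.algebraMap_apply, CF.sum_apply, CF.mul_apply, CF.sub_apply,
      chartCoord_apply, h2, one_smul, h3]
    congr 1
    have hd : φ q' - φ q = ∑ i, (φ q' i - φ q i) • EuclideanSpace.single i (1 : ℝ) := by
      ext j
      simp [Finset.sum_apply, Pi.single_apply]
    rw [hd, map_sum]
    refine Finset.sum_congr rfl fun i _ => ?_
    rw [map_smul, Complex.real_smul, Complex.ofReal_sub]
  rw [V.congr_of_eventually_eq hf, map_add, Derivation.map_algebraMap, zero_add, map_sum,
    CF.sum_apply]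
  refine Finset.sum_congr rfl fun i _ => ?_
  rw [Derivation.leibniz, map_sub, Derivation.map_algebraMap, chartVec_apply,
    chartDeriv_congr _ hq hfh, ← hga]
  simp only [smul_eq_mul, CF.add_apply, CF.mul_apply, CF.sub_apply, CF.algebraMap_apply,
    chartCoord_apply, hb.self_of_nhds, one_smul, (hG i).self_of_nhds, CF.zero_apply]
  ring

theorem chartVec_chartCoord {p : M} (b : SmoothBumpFunction (𝓡 3) p) {q : M}
    (hq : q ∈ (extChartAt (𝓡 3) p).source) (hb : ∀ᶠ q' in 𝓝 q, b q' = 1) (i j : Fin 3) :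
    chartVec b (EuclideanSpace.single i 1) (chartCoord b j) q = if i = j then 1 else 0 := by
  rw [chartVec_apply, hb.self_of_nhds, one_smul, chartDeriv_congr
    (h := Complex.ofRealCLM.comp (EuclideanSpace.proj j)) _ hq
    (by filter_upwards [hb] with q' h; simp [chartCoord_apply, h]), ContinuousLinearMap.fderiv]
  by_cases hij : i = j
  · simp [hij]
  · simp [hij, Ne.symm hij]

/-- The hypothesis is closedness of `∑ a_j dx_j`. A ball in the chart is convex, so the form has a
primitive there, and its germ extends to a global function. -/
theorem chartVec_primitive {p : M} (b : SmoothBumpFunction (𝓡 3) p) (a : Fin 3 → CF M)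
    (ha : ∀ᶠ q in 𝓝 p, ∀ i j, chartVec b (EuclideanSpace.single i 1) (a j) q =
      chartVec b (EuclideanSpace.single j 1) (a i) q) :
    ∃ G : CF M, ∀ᶠ q in 𝓝 p, ∀ i, chartVec b (EuclideanSpace.single i 1) G q = a i q := by
  set φ := extChartAt (𝓡 3) p with hφ
  have hp : p ∈ φ.source := mem_extChartAt_source p
  have hb : ∀ᶠ q in 𝓝 p, b q = 1 := b.eventuallyEq_one
  obtain ⟨r, hr, hB⟩ := Metric.eventually_nhds_iff_ball.1
    ((eventually_of_eventually_nhds_symm (ha.and hb)).and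
      ((isOpen_extChartAt_target p).mem_nhds (φ.map_source hp)))
  set B := Metric.ball (φ p) r
  have hBt : B ⊆ φ.target := fun y hy => (hB y hy).2
  let α : EuclideanSpace ℝ (Fin 3) → EuclideanSpace ℝ (Fin 3) →L[ℝ] ℂ := fun y =>
    ∑ j, (EuclideanSpace.proj j : EuclideanSpace ℝ (Fin 3) →L[ℝ] ℝ).smulRight ((a j ∘ φ.symm) y)
  have hsm : ∀ j, ContDiffOn ℝ ∞ (a j ∘ φ.symm) B := fun j =>
    ((a j).contDiffOn_comp_extChartAt_symm p).mono hBt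
  have hαs : ContDiffOn ℝ ∞ α B := ContDiffOn.sum fun j _ => contDiffOn_const.smulRight (hsm j)
  have hαd : ∀ y ∈ B, ∀ u v, fderiv ℝ α y u v =
      ∑ j, v j • fderiv ℝ (a j ∘ φ.symm) y u := fun y hy u v => by
    have h1 : HasFDerivAt α (∑ j, (ContinuousLinearMap.smulRightL ℝ _ _
        (EuclideanSpace.proj j : EuclideanSpace ℝ (Fin 3) →L[ℝ] ℝ)).comp
          (fderiv ℝ (a j ∘ φ.symm) y)) y := by
      refine HasFDerivAt.fun_sum fun j _ => ?_
      exact (ContinuousLinearMap.smulRightL ℝ _ _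
        (EuclideanSpace.proj j : EuclideanSpace ℝ (Fin 3) →L[ℝ] ℝ)).hasFDerivAt.comp y
        (((hsm j).contDiffAt (Metric.isOpen_ball.mem_nhds hy)).differentiableAt
          (by simp)).hasFDerivAt
    rw [h1.fderiv]
    simp
  have hclosed : ∀ y ∈ B, ∀ u v, fderiv ℝ α y u v = fderiv ℝ α y v u := fun y hy u v => by
    have hd : ∀ u : EuclideanSpace ℝ (Fin 3), u = ∑ i, u i • EuclideanSpace.single i (1 : ℝ) := by
      intro u
      ext j
      simp [Finset.sum_apply, Pi.single_apply]
    have hs : ∀ i j, fderiv ℝ (a j ∘ φ.symm) y (EuclideanSpace.single i 1) =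
        fderiv ℝ (a i ∘ φ.symm) y (EuclideanSpace.single j 1) := fun i j => by
      obtain ⟨⟨h1, h2⟩, h3⟩ := hB y hy
      have := h1 i j
      rw [chartVec_apply, chartVec_apply, h2, one_smul, one_smul, chartDeriv, chartDeriv,
        ← hφ, φ.right_inv h3] at this
      exact this
    have he : ∀ u v : EuclideanSpace ℝ (Fin 3), ∑ j, v j • fderiv ℝ (a j ∘ φ.symm) y u =
        ∑ j, ∑ i, v j • u i • fderiv ℝ (a j ∘ φ.symm) y (EuclideanSpace.single i 1) := by
      intro u v
      refine Finset.sum_congr rfl fun j _ => ?_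
      conv_lhs => rw [hd u, map_sum, Finset.smul_sum]
      refine Finset.sum_congr rfl fun i _ => ?_
      rw [map_smul]
    rw [hαd y hy, hαd y hy, he u v, he v u, Finset.sum_comm]
    refine Finset.sum_congr rfl fun i _ => Finset.sum_congr rfl fun j _ => ?_
    rw [hs i j, smul_comm]
  obtain ⟨G, hG⟩ := (convex_ball (φ p) r).exists_forall_hasFDerivAt_of_fderiv_symmetric
    Metric.isOpen_ball (hαs.differentiableOn (by simp)) hclosed
  -- The primitive is smooth because its derivative `α` is.
  have hGs : ContDiffOn ℝ ∞ G B := by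
    rw [contDiffOn_infty_iff_fderiv_of_isOpen Metric.isOpen_ball]
    exact ⟨fun y hy => (hG y hy).differentiableAt.differentiableWithinAt,
      hαs.congr fun y hy => (hG y hy).fderiv⟩
  have hφc : Tendsto φ (𝓝 p) (𝓝 (φ p)) := continuousAt_extChartAt p
  have hφB : ∀ᶠ q in 𝓝 p, q ∈ φ.source ∩ φ ⁻¹' B :=
    Filter.inter_mem ((isOpen_extChartAt_source p).mem_nhds hp)
      (hφc.eventually (Metric.isOpen_ball.mem_nhds (Metric.mem_ball_self hr)))
  obtain ⟨G', hG'⟩ := exists_eventually_eq_of_contMDiffOn hφB (contMDiffOn_comp_extChartAt hGs)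
  refine ⟨G', ?_⟩
  filter_upwards [hG'.eventually_nhds, hφB, hb] with q h1 h2 h3 i
  rw [chartVec_apply, h3, one_smul, chartDeriv_congr _ h2.1 h1, (hG _ h2.2).fderiv]
  simp [α, φ.left_inv h2.1]

theorem nonempty_chartFrame (p : M) : Nonempty (ChartFrame p) := by
  obtain ⟨b⟩ : Nonempty (SmoothBumpFunction (𝓡 3) p) := inferInstance
  have hs : ∀ᶠ q in 𝓝 p, q ∈ (extChartAt (𝓡 3) p).source :=
    (isOpen_extChartAt_source p).mem_nhds (mem_extChartAt_source p)
  obtain ⟨U, hU, hUo, hpU⟩ := mem_nhds_iff.1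
    (hs.and b.eventuallyEq_one.eventually_nhds)
  exact ⟨⟨U, hUo, hpU, chartCoord b, fun i => chartVec b (EuclideanSpace.single i 1),
    fun q hq => chartVec_chartCoord b (hU hq).1 (hU hq).2,
    fun q hq => chartVec_expand b (hU hq).1 (hU hq).2,
    chartVec_primitive b⟩⟩

end ChartFrame

/-! ### Exterior derivative, and pointwise nature of forms -/

section Tensor

variable {M : Type*} [TopologicalSpace M] [ChartedSpace (EuclideanSpace ℝ (Fin 3)) M]

theorem conjV_conjV (V : Vec M) : conjV (conjV V) = V := by
  ext1 f
  simp only [conjV_apply, conjF_conjF]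

theorem conjV_smul (b : CF M) (V : Vec M) : conjV (b • V) = conjF b • conjV V := by
  ext1 f
  simp only [conjV_apply, Derivation.smul_apply, smul_eq_mul, map_mul]

theorem conjV_lie (V W : Vec M) : conjV ⁅V, W⁆ = ⁅conjV V, conjV W⁆ := by
  ext1 f
  simp only [conjV_apply, Derivation.commutator_apply, map_sub, conjF_conjF]

theorem conjForm_apply (α : Form1 M) (V : Vec M) : conjForm α V = conjF (α (conjV V)) := rfl

theorem wedge_apply (α β : Form1 M) (V W : Vec M) (p : M) :
    wedge α β V W p = α V p * β W p - α W p * β V p := by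
  simp only [wedge, LinearMap.sub_apply, LinearMap.smulRight_apply, LinearMap.smul_apply,
    smul_eq_mul, CF.sub_apply, CF.mul_apply]
  ring

theorem smul_lie_vec (f : CF M) (V W : Vec M) : ⁅f • V, W⁆ = f • ⁅V, W⁆ - W f • V := by
  ext1 g
  simp only [Derivation.commutator_apply, Derivation.smul_apply, smul_eq_mul, Derivation.leibniz,
    Derivation.sub_apply]
  ring

theorem dForm_swap (α : Form1 M) (V W : Vec M) : dForm α W V = -dForm α V W := by
  rw [dForm, dForm, ← lie_skew, map_neg]
  ring

theorem dForm_self (α : Form1 M) (V : Vec M) : dForm α V V = 0 := by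
  rw [dForm, lie_self, map_zero, sub_self, sub_zero]

theorem dForm_add_left (α : Form1 M) (V V' W : Vec M) :
    dForm α (V + V') W = dForm α V W + dForm α V' W := by
  simp only [dForm, Derivation.add_apply, map_add, add_lie]
  ring

/-- The term `(W f) α(V)` from the Leibniz rule cancels against the one from the bracket `⁅f • V,
W⁆`. -/
theorem dForm_smul_left (α : Form1 M) (f : CF M) (V W : Vec M) :
    dForm α (f • V) W = f * dForm α V W := by
  simp only [dForm, smul_lie_vec, Derivation.smul_apply, smul_eq_mul, map_smul, map_sub,
    Derivation.leibniz]
  ring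

/-- The exterior derivative of a `1`-form, as a bilinear map. -/
def extDeriv (α : Form1 M) : Form2 M :=
  LinearMap.mk₂ (CF M) (dForm α) (dForm_add_left α) (dForm_smul_left α)
    (fun V W W' => by
      rw [dForm_swap α (W + W') V, dForm_add_left, dForm_swap α W V, dForm_swap α W' V, neg_add])
    (fun f V W => by
      rw [dForm_swap α (f • W) V, dForm_smul_left, dForm_swap α W V, smul_eq_mul, mul_neg])

theorem extDeriv_apply (α : Form1 M) (V W : Vec M) : extDeriv α V W = dForm α V W := rfl

theorem dForm_conjV (α : Form1 M) (V W : Vec M) :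
    dForm α (conjV V) (conjV W) = conjF (dForm (conjForm α) V W) := by
  simp only [dForm, conjForm_apply, map_sub, conjF_conjF, conjV_lie, conjV_apply]

/-- `d (d α) = 0`. -/
theorem dForm_cyclic (α : Form1 M) (X Y Z : Vec M) :
    X (dForm α Y Z) - Y (dForm α X Z) + Z (dForm α X Y)
      - dForm α ⁅X, Y⁆ Z + dForm α ⁅X, Z⁆ Y - dForm α ⁅Y, Z⁆ X = 0 := by
  have hj : α ⁅⁅X, Y⁆, Z⁆ - α ⁅⁅X, Z⁆, Y⁆ + α ⁅⁅Y, Z⁆, X⁆ = 0 := by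
    rw [← map_sub, ← map_add]
    have : ⁅⁅X, Y⁆, Z⁆ - ⁅⁅X, Z⁆, Y⁆ + ⁅⁅Y, Z⁆, X⁆ = 0 := by
      ext1 f
      simp only [Derivation.commutator_apply, Derivation.add_apply, Derivation.sub_apply,
        Derivation.zero_apply, map_sub]
      ring
    rw [this, map_zero]
  simp only [dForm, map_sub, Derivation.commutator_apply]
  linear_combination hj

variable [T2Space M] [IsManifold (𝓡 3) ∞ M]

theorem Vec.apply_eq_zero_of_const (V : Vec M) {f : CF M} {c : ℂ} {U : Set M} (hU : IsOpen U)
    (h : ∀ q ∈ U, f q = c) {p : M} (hp : p ∈ U) : V f p = 0 := by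
  rw [V.congr_on hU (g := algebraMap ℂ (CF M) c) h hp, Derivation.map_algebraMap]
  rfl

/-- The expansion of `V` in coordinate fields holds only on `C.U`. Multiplied by a cutoff it is an
identity of global derivations, to which the function-linear `α` can be applied. -/
theorem ChartFrame.form_expand {p : M} (C : ChartFrame p) {q : M} (hq : q ∈ C.U) (α : Form1 M)
    (V : Vec M) : α V q = ∑ i, V (C.x i) q * α (C.X i) q := by
  obtain ⟨χ, hχ1, hχ0⟩ := exists_bump (C.isOpen.mem_nhds hq)
  have h : χ • V = ∑ i, (χ * V (C.x i)) • C.X i := by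
    ext f q
    simp only [Fin.sum_univ_three, Derivation.add_apply, Derivation.smul_apply, smul_eq_mul,
      CF.mul_apply, CF.add_apply]
    by_cases hq : q ∈ C.U
    · rw [C.expand q hq V f, Fin.sum_univ_three]
      ring
    · simp [hχ0 q hq]
  have h1 := congrArg (fun W => α W q) h
  simpa [hχ1.self_of_nhds] using h1

/-- `1`-forms are pointwise operators. -/
theorem form_congr_at (α : Form1 M) {V W : Vec M} {p : M} (h : ∀ f, V f p = W f p) :
    α V p = α W p := by
  obtain ⟨C⟩ := nonempty_chartFrame p
  rw [C.form_expand C.mem, C.form_expand C.mem α W]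
  simp only [h]

theorem dForm_congr_at (α : Form1 M) {V V' W W' : Vec M} {p : M} (h : ∀ f, V f p = V' f p)
    (h' : ∀ f, W f p = W' f p) : dForm α V W p = dForm α V' W' p := by
  rw [← extDeriv_apply, ← extDeriv_apply, form_congr_at _ h']
  exact form_congr_at ((extDeriv α).flip W') h

/-- Dual bases span, as the tangent spaces are three-dimensional. -/
theorem expand_of_dual {p : M} (α : Fin 3 → Form1 M) (e : Fin 3 → Vec M)
    (h : ∀ i j, α i (e j) p = if i = j then 1 else 0) (V : Vec M) (f : CF M) :
    V f p = ∑ i, α i V p * e i f p := by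
  obtain ⟨C⟩ := nonempty_chartFrame p
  -- `A` and `B` express the forms and the vectors in the chart frame. Duality is `A * B = 1`; for
  -- square matrices this gives `B * A = 1`, which says that the `e i` span.
  let A : Matrix (Fin 3) (Fin 3) ℂ := fun i k => α i (C.X k) p
  let B : Matrix (Fin 3) (Fin 3) ℂ := fun k j => e j (C.x k) p
  have hAB : A * B = 1 := by
    ext i j
    rw [Matrix.mul_apply, Matrix.one_apply, ← h i j, C.form_expand C.mem]
    exact Finset.sum_congr rfl fun k _ => mul_comm _ _
  have hBA : B * A = 1 := mul_eq_one_comm.1 hAB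
  have hBA' : ∀ l k, ∑ i, B l i * A i k = if l = k then 1 else 0 := fun l k => by
    rw [← Matrix.mul_apply, hBA, Matrix.one_apply]
  calc V f p = ∑ k, ∑ l, V (C.x k) p * (if l = k then 1 else 0) * C.X l f p := by
        rw [C.expand p C.mem]
        simp
    _ = ∑ i, (∑ k, V (C.x k) p * A i k) * ∑ l, B l i * C.X l f p := by
        simp only [← hBA', Finset.mul_sum, Finset.sum_mul]
        rw [Finset.sum_comm_cycle]
        refine Finset.sum_congr rfl fun i _ => ?_
        rw [Finset.sum_comm]
        refine Finset.sum_congr rfl fun k _ => Finset.sum_congr rfl fun l _ => ?_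
        ring
    _ = ∑ i, α i V p * e i f p := by
        refine Finset.sum_congr rfl fun i _ => ?_
        rw [C.form_expand C.mem, C.expand p C.mem (e i)]

theorem form_expand_at {p : M} {a b c : Form1 M} {A B C : Vec M}
    (h : ∀ (V : Vec M) (f : CF M), V f p = a V p * A f p + b V p * B f p + c V p * C f p)
    (α : Form1 M) (V : Vec M) : α V p = a V p * α A p + b V p * α B p + c V p * α C p := by
  rw [form_congr_at α (W := a V • A + b V • B + c V • C) (fun f => by
    rw [h V f]
    simp only [Derivation.add_apply, Derivation.smul_apply, smul_eq_mul, CF.add_apply,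
      CF.mul_apply])]
  simp only [map_add, map_smul, smul_eq_mul, CF.add_apply, CF.mul_apply]

end Tensor

/-! ### Structure equations and commutation rules in a local frame -/

section Frame

variable {M : Type*} [TopologicalSpace M] [ChartedSpace (EuclideanSpace ℝ (Fin 3)) M]

namespace Pseudohermitian

variable (S : Pseudohermitian M)

theorem mem_T10_iff {V : Vec M} :
    V ∈ S.T10 ↔ ∃ h : S.θ V = 0, S.J ⟨V, h⟩ = algebraMap ℂ (CF M) Complex.I • ⟨V, h⟩ := by
  rw [T10, Submodule.mem_map]
  constructor
  · rintro ⟨y, hy, rfl⟩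
    refine ⟨y.2, ?_⟩
    rw [LinearMap.mem_ker, LinearMap.sub_apply, sub_eq_zero] at hy
    exact hy
  · rintro ⟨h, hJ⟩
    refine ⟨⟨V, h⟩, ?_, rfl⟩
    rw [LinearMap.mem_ker, LinearMap.sub_apply, sub_eq_zero]
    exact hJ

theorem θ_conjV (V : Vec M) : S.θ (conjV V) = conjF (S.θ V) := by
  conv_lhs => rw [← S.θ_real, conjForm_apply, conjV_conjV]

theorem θ_eq_zero {V : Vec M} (h : V ∈ S.T10) : S.θ V = 0 := (S.mem_T10_iff.1 h).1

theorem θ_conjV_eq_zero {V : Vec M} (h : V ∈ S.T10) : S.θ (conjV V) = 0 := by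
  rw [θ_conjV, S.θ_eq_zero h, map_zero]

theorem dForm_θ_conjV (V W : Vec M) :
    dForm S.θ (conjV V) (conjV W) = conjF (dForm S.θ V W) := by
  rw [dForm_conjV, S.θ_real]

theorem J_conjV {V : Vec M} (h : V ∈ S.T10) :
    S.J ⟨conjV V, S.θ_conjV_eq_zero h⟩ =
      -(algebraMap ℂ (CF M) Complex.I • ⟨conjV V, S.θ_conjV_eq_zero h⟩) := by
  obtain ⟨h0, hJ⟩ := S.mem_T10_iff.1 h
  apply Subtype.ext
  rw [S.J_real ⟨V, h0⟩ ⟨conjV V, S.θ_conjV_eq_zero h⟩ rfl, hJ]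
  change conjV (algebraMap ℂ (CF M) Complex.I • V) =
    -(algebraMap ℂ (CF M) Complex.I • conjV V)
  rw [conjV_smul, ← neg_smul]
  congr 1
  ext q
  change (starRingEnd ℂ) Complex.I = -Complex.I
  exact Complex.conj_I

/-- Up to the factor `2` this is the projection to the `+i`-eigenspace: `J (V - i J V) = J V + i V =
i (V - i J V)`. -/
theorem sub_I_J_mem_T10 (V : LinearMap.ker S.θ) :
    ((V - algebraMap ℂ (CF M) Complex.I • S.J V : LinearMap.ker S.θ) : Vec M) ∈ S.T10 := by
  rw [mem_T10_iff]
  refine ⟨(V - algebraMap ℂ (CF M) Complex.I • S.J V : LinearMap.ker S.θ).2, ?_⟩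
  have hI : algebraMap ℂ (CF M) Complex.I * algebraMap ℂ (CF M) Complex.I = -1 := by
    rw [← map_mul, Complex.I_mul_I, map_neg, map_one]
  rw [Subtype.coe_eta, map_sub, map_smul, S.J_sq, smul_sub, smul_smul, hI]
  simp only [smul_neg, neg_smul, one_smul]
  abel

/-- `dθ` is real and alternating, so `-i dθ(Z, conj Z)` is real-valued; positivity of its real part
is therefore positivity of the function itself. -/
theorem conjF_levi (Z : Vec M) :
    conjF ((-Complex.I) • dForm S.θ Z (conjV Z)) = (-Complex.I) • dForm S.θ Z (conjV Z) := by
  rw [conjF_smul, ← S.dForm_θ_conjV, conjV_conjV, dForm_swap, map_neg, Complex.conj_I, smul_neg,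
    neg_neg, neg_smul]

namespace LocalFrame

variable {S} (F : S.LocalFrame)

theorem conjV_Z : conjV F.Z = F.Zbar := rfl

theorem conjV_Zbar : conjV F.Zbar = F.Z := conjV_conjV _

theorem Zbar_apply (f : CF M) : F.Zbar f = conjF (F.Z (conjF f)) := rfl

theorem conjF_Z (f : CF M) : conjF (F.Z f) = F.Zbar (conjF f) := by
  rw [Zbar_apply, conjF_conjF]

theorem conjF_Zbar (f : CF M) : conjF (F.Zbar f) = F.Z (conjF f) := by
  rw [Zbar_apply, conjF_conjF]

theorem θ_Z : S.θ F.Z = 0 := S.θ_eq_zero F.Z_mem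

theorem θ_Zbar : S.θ F.Zbar = 0 := S.θ_conjV_eq_zero F.Z_mem

/-- A frame does not assume `T` real, so this is not the conjugate of `θ1_T`; it is the Levi
equation on `(T, Z_1)` together with `dθ(T, ·) = 0`. -/
theorem conjθ1_T {p : M} (hp : p ∈ F.U) : conjForm F.θ1 F.T p = 0 := by
  have h1 := F.levi p hp F.T F.Z
  rw [F.dθ_T p hp, wedge_apply, F.θ1_T p hp, F.θ1_Z p hp] at h1
  have h2 : Complex.I * conjForm F.θ1 F.T p = 0 := by linear_combination h1
  simpa using h2

theorem conjθ1_Z {p : M} (hp : p ∈ F.U) : conjForm F.θ1 F.Z p = 0 := by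
  rw [conjForm_apply, conjF_apply, F.θ1_Zbar p hp, map_zero]

theorem conjθ1_Zbar {p : M} (hp : p ∈ F.U) : conjForm F.θ1 F.Zbar p = 1 := by
  rw [conjForm_apply, conjF_apply, conjV_Zbar, F.θ1_Z p hp, map_one]

theorem θ1_Zbar' {p : M} (hp : p ∈ F.U) : F.θ1 F.Zbar p = 0 := F.θ1_Zbar p hp

theorem conj_conn_Z {p : M} (hp : p ∈ F.U) :
    (starRingEnd ℂ) (F.conn F.Z p) = -F.conn F.Zbar p := by
  have := F.skew p hp F.Zbar
  rw [CF.add_apply, conjForm_apply, conjF_apply, conjV_Zbar] at this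
  linear_combination this

theorem conj_conn_Zbar {p : M} (hp : p ∈ F.U) :
    (starRingEnd ℂ) (F.conn F.Zbar p) = -F.conn F.Z p := by
  have := F.skew p hp F.Z
  rw [CF.add_apply, conjForm_apply, conjF_apply, conjV_Z] at this
  linear_combination this

theorem cov_zero_one_Z {p : M} (hp : p ∈ F.U) (s : CF M) :
    F.cov 0 1 F.Z s p = (F.Z s + F.conn F.Z * s) p := by
  simp only [cov, zero_smul, one_smul, zero_add, CF.sub_apply, CF.mul_apply, CF.add_apply]
  rw [conjForm_apply, conjF_apply, conjV_Z, F.conj_conn_Zbar hp]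
  ring

theorem isOpen_inter (F' : S.LocalFrame) : IsOpen (F.U ∩ F'.U) := F.isOpen.inter F'.isOpen

variable [T2Space M] [IsManifold (𝓡 3) ∞ M]

theorem expand {p : M} (hp : p ∈ F.U) (V : Vec M) (f : CF M) :
    V f p = S.θ V p * F.T f p + F.θ1 V p * F.Z f p + conjForm F.θ1 V p * F.Zbar f p := by
  have h := expand_of_dual (p := p) ![S.θ, F.θ1, conjForm F.θ1] ![F.T, F.Z, F.Zbar] (by
    intro i j
    fin_cases i <;> fin_cases j <;>
      simp [F.θ_T p hp, F.θ1_T p hp, F.θ1_Z p hp, F.θ1_Zbar' hp, F.conjθ1_T hp, F.conjθ1_Z hp,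
        F.conjθ1_Zbar hp, F.θ_Z, F.θ_Zbar]) V f
  simpa [Fin.sum_univ_three] using h

theorem form_expand {p : M} (hp : p ∈ F.U) (α : Form1 M) (V : Vec M) :
    α V p = S.θ V p * α F.T p + F.θ1 V p * α F.Z p + conjForm F.θ1 V p * α F.Zbar p :=
  form_expand_at (F.expand hp) α V

/-- `θ` is real, and both `θ^1` and `θ^{\bar 1}` vanish on `T`, so `conj T` has the same components
as `T`. -/
theorem conjV_T {p : M} (hp : p ∈ F.U) (f : CF M) : conjV F.T f p = F.T f p := by
  rw [F.expand hp (conjV F.T) f, conjForm_apply, conjV_conjV, conjF_apply, F.θ1_T p hp,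
    S.θ_conjV, conjF_apply, F.θ_T p hp]
  have h : F.θ1 (conjV F.T) p = 0 := by
    have := F.conjθ1_T hp
    rwa [conjForm_apply, conjF_apply, map_eq_zero] at this
  rw [h]
  simp

theorem conj_T_apply {p : M} (hp : p ∈ F.U) (f : CF M) :
    (starRingEnd ℂ) (F.T f p) = F.T (conjF f) p := by
  rw [← F.conjV_T hp (conjF f), conjV_apply, conjF_conjF, conjF_apply]

/-- The derivative of a form that is constant along a frame vector field. -/
theorem dForm_eq_neg {α : Form1 M} {V W : Vec M} {a b : ℂ} (hV : ∀ q ∈ F.U, α V q = a)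
    (hW : ∀ q ∈ F.U, α W q = b) {p : M} (hp : p ∈ F.U) : dForm α V W p = -α ⁅V, W⁆ p := by
  simp only [dForm, CF.sub_apply, V.apply_eq_zero_of_const F.isOpen hW hp,
    W.apply_eq_zero_of_const F.isOpen hV hp]
  ring

/-- The coframe is constant on the frame, so `dα(V, W) = -α(⁅V, W⁆)`. The Levi and structure
equations thus give the components of the brackets, here and for the other pairs. -/
theorem θ_lie_Z_Zbar {p : M} (hp : p ∈ F.U) : S.θ ⁅F.Z, F.Zbar⁆ p = -Complex.I := by
  have h1 := F.levi p hp F.Z F.Zbar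
  rw [F.dForm_eq_neg (fun q _ => by rw [F.θ_Z]; rfl) (fun q _ => by rw [F.θ_Zbar]; rfl) hp,
    wedge_apply, F.θ1_Z p hp, F.θ1_Zbar' hp, F.conjθ1_Zbar hp] at h1
  linear_combination -h1

theorem θ_lie_T_Z {p : M} (hp : p ∈ F.U) : S.θ ⁅F.T, F.Z⁆ p = 0 := by
  have h1 := F.dθ_T p hp F.Z
  rw [F.dForm_eq_neg F.θ_T (fun q _ => by rw [F.θ_Z]; rfl) hp] at h1
  linear_combination -h1

theorem θ1_lie_Z_Zbar {p : M} (hp : p ∈ F.U) :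
    F.θ1 ⁅F.Z, F.Zbar⁆ p = -F.conn F.Zbar p := by
  have h1 := F.struct_eq p hp F.Z F.Zbar
  rw [F.dForm_eq_neg F.θ1_Z (fun q hq => F.θ1_Zbar' hq) hp, wedge_apply, wedge_apply, F.θ_Z,
    F.θ_Zbar, F.θ1_Z p hp, F.θ1_Zbar' hp] at h1
  simp only [CF.zero_apply] at h1
  linear_combination -h1

theorem θ1_lie_T_Z {p : M} (hp : p ∈ F.U) : F.θ1 ⁅F.T, F.Z⁆ p = F.conn F.T p := by
  have h1 := F.struct_eq p hp F.T F.Z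
  rw [F.dForm_eq_neg F.θ1_T F.θ1_Z hp, wedge_apply, wedge_apply, F.θ_Z, F.θ_T p hp,
    F.θ1_Z p hp, F.θ1_T p hp, F.conjθ1_Z hp, F.conjθ1_T hp] at h1
  simp only [CF.zero_apply] at h1
  linear_combination -h1

theorem θ1_lie_T_Zbar {p : M} (hp : p ∈ F.U) : F.θ1 ⁅F.T, F.Zbar⁆ p = -F.torsion p := by
  have h1 := F.struct_eq p hp F.T F.Zbar
  rw [F.dForm_eq_neg F.θ1_T (fun q hq => F.θ1_Zbar' hq) hp, wedge_apply, wedge_apply,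
    F.θ_Zbar, F.θ_T p hp, F.θ1_Zbar' hp, F.θ1_T p hp, F.conjθ1_Zbar hp, F.conjθ1_T hp] at h1
  simp only [CF.zero_apply] at h1
  linear_combination -h1

theorem conjForm_θ1_lie_Z_Zbar {p : M} (hp : p ∈ F.U) :
    conjForm F.θ1 ⁅F.Z, F.Zbar⁆ p = -F.conn F.Z p := by
  rw [conjForm_apply, conjV_lie, conjV_Zbar, conjV_Z, ← lie_skew, map_neg, conjF_apply,
    CF.neg_apply, F.θ1_lie_Z_Zbar hp, neg_neg, F.conj_conn_Zbar hp]

/-- `f_{1\bar 1} - f_{\bar 1 1} = i f_0`. -/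
theorem commutator_Z_Zbar {p : M} (hp : p ∈ F.U) (f : CF M) :
    F.Z (F.Zbar f) p - F.Zbar (F.Z f) p =
      -Complex.I * F.T f p - F.conn F.Zbar p * F.Z f p - F.conn F.Z p * F.Zbar f p := by
  have h := F.expand hp ⁅F.Z, F.Zbar⁆ f
  rw [Derivation.commutator_apply, CF.sub_apply, F.θ_lie_Z_Zbar hp, F.θ1_lie_Z_Zbar hp,
    F.conjForm_θ1_lie_Z_Zbar hp] at h
  linear_combination h

theorem conjForm_θ1_lie_T_Z {p : M} (hp : p ∈ F.U) :
    conjForm F.θ1 ⁅F.T, F.Z⁆ p = -F.A11 p := by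
  have h : ∀ q ∈ F.U, ∀ f, ⁅conjV F.T, F.Zbar⁆ f q = ⁅F.T, F.Zbar⁆ f q := fun q hq f => by
    simp only [Derivation.commutator_apply, CF.sub_apply, F.conjV_T hq]
    rw [F.Zbar.congr_on F.isOpen (fun q hq => F.conjV_T hq f) hq]
  rw [conjForm_apply, conjV_lie, conjV_Z, conjF_apply, form_congr_at F.θ1 (h p hp),
    F.θ1_lie_T_Zbar hp, map_neg]
  rfl

/-- `f_{01} - f_{10} = A_{11} f_{\bar 1}`. -/
theorem commutator_T_Z {p : M} (hp : p ∈ F.U) (f : CF M) :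
    F.T (F.Z f) p - F.Z (F.T f) p = F.conn F.T p * F.Z f p - F.A11 p * F.Zbar f p := by
  have h := F.expand hp ⁅F.T, F.Z⁆ f
  rw [Derivation.commutator_apply, CF.sub_apply, F.θ_lie_T_Z hp, F.θ1_lie_T_Z hp,
    F.conjForm_θ1_lie_T_Z hp] at h
  linear_combination h

/-- The inner derivative has one index of each type, so the connection terms of the outer one cancel
by skewness. -/
theorem cbar11_apply {p : M} (hp : p ∈ F.U) (s : CF M) :
    F.cbar11 s p = F.Z (F.Z s + F.conn F.Z * s) p := by
  rw [cbar11, cov, CF.sub_apply, CF.mul_apply, one_smul, one_smul, F.skew p hp, zero_mul, sub_zero]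
  exact F.Z.congr_on F.isOpen (fun q hq => F.cov_zero_one_Z hq s) hp

theorem c1bar_congr {s s' : CF M} (h : ∀ q ∈ F.U, s q = s' q) {p : M} (hp : p ∈ F.U) :
    F.c1bar s p = F.c1bar s' p := by
  simp only [c1bar, cov, CF.sub_apply, CF.mul_apply, F.Zbar.congr_on F.isOpen h hp, h p hp]

theorem cbar11_congr {s s' : CF M} (h : ∀ q ∈ F.U, s q = s' q) {p : M} (hp : p ∈ F.U) :
    F.cbar11 s p = F.cbar11 s' p := by
  rw [F.cbar11_apply hp, F.cbar11_apply hp]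
  refine F.Z.congr_on F.isOpen (fun q hq => ?_) hp
  simp only [CF.add_apply, CF.mul_apply, h q hq, F.Z.congr_on F.isOpen h hq]

/-- The coefficient `f_{\bar 1 1 1} + i A_{11} f_{\bar 1}` of `P_3 f`. -/
def coeff (f : CF M) : CF M := F.cbar11 (F.Zbar f) + Complex.I • (F.A11 * F.Zbar f)

theorem coeff_apply {p : M} (hp : p ∈ F.U) (f : CF M) :
    F.coeff f p = F.Z (F.Z (F.Zbar f) + F.conn F.Z * F.Zbar f) p +
      Complex.I * (F.A11 p * F.Zbar f p) := by
  rw [coeff, CF.add_apply, F.cbar11_apply hp, CF.smul_apply, CF.mul_apply]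

/-- Sections of `T_{1,0}` are multiples of `Z_1`. -/
theorem conjForm_θ1_eq_zero {V : Vec M} (hV : V ∈ S.T10) {p : M} (hp : p ∈ F.U) :
    conjForm F.θ1 V p = 0 := by
  obtain ⟨χ, hχ1, hχ0⟩ := exists_bump (F.isOpen.mem_nhds hp)
  obtain ⟨hθ, hJ⟩ := S.mem_T10_iff.1 hV
  obtain ⟨hθZ, hJZ⟩ := S.mem_T10_iff.1 F.Z_mem
  -- Applying `J` multiplies `V` and `Z_1` by `i` but `Z_{\bar 1}` by `-i`; comparing the `Z_{\bar
  -- 1}`-components shows that `2i` times the last coefficient vanishes.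
  have h : χ • (⟨V, hθ⟩ : LinearMap.ker S.θ) = (χ * F.θ1 V) • (⟨F.Z, hθZ⟩ : LinearMap.ker S.θ) +
      (χ * conjForm F.θ1 V) • (⟨F.Zbar, F.θ_Zbar⟩ : LinearMap.ker S.θ) := by
    apply Subtype.ext
    ext f q
    change χ q * V f q = χ q * F.θ1 V q * F.Z f q + χ q * conjForm F.θ1 V q * F.Zbar f q
    by_cases hq : q ∈ F.U
    · rw [F.expand hq V f, hθ, CF.zero_apply]
      ring
    · simp [hχ0 q hq]
  have h2 := congrArg S.J h
  have hJb : S.J (⟨F.Zbar, F.θ_Zbar⟩ : LinearMap.ker S.θ) =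
      -(algebraMap ℂ (CF M) Complex.I • ⟨F.Zbar, F.θ_Zbar⟩) := S.J_conjV F.Z_mem
  rw [map_smul, map_add, map_smul, map_smul, hJ, hJZ, hJb] at h2
  have h3 := congrArg (fun W : LinearMap.ker S.θ => conjForm F.θ1 (W : Vec M) p) h2
  simp only [Submodule.coe_smul, Submodule.coe_add, Submodule.coe_neg, map_add, map_smul, map_neg,
    smul_eq_mul, CF.add_apply, CF.mul_apply, CF.neg_apply, CF.algebraMap_apply, F.conjθ1_Z hp,
    F.conjθ1_Zbar hp, hχ1.self_of_nhds] at h3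
  have h4 : (2 * Complex.I) * conjForm F.θ1 V p = 0 := by linear_combination h3
  simpa using h4

theorem eq_smul_Z {V : Vec M} (hV : V ∈ S.T10) {p : M} (hp : p ∈ F.U) (f : CF M) :
    V f p = F.θ1 V p * F.Z f p := by
  rw [F.expand hp V f, S.θ_eq_zero hV, F.conjForm_θ1_eq_zero hV hp]
  simp

end LocalFrame

end Pseudohermitian

end Frame

/-! ### Behaviour under a change of frame -/

section FrameChange

variable {M : Type*} [TopologicalSpace M] [ChartedSpace (EuclideanSpace ℝ (Fin 3)) M]
  [T2Space M] [IsManifold (𝓡 3) ∞ M]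

namespace Pseudohermitian

namespace LocalFrame

variable {S : Pseudohermitian M} (F F' : S.LocalFrame)

/-- The transition function `u` with `Z'_1 = u Z_1`. -/
def transition : CF M := F.θ1 F'.Z

theorem Z_change {p : M} (hp : p ∈ F.U ∩ F'.U) (f : CF M) :
    F'.Z f p = F.transition F' p * F.Z f p := F.eq_smul_Z F'.Z_mem hp.1 f

theorem Zbar_change {p : M} (hp : p ∈ F.U ∩ F'.U) (f : CF M) :
    F'.Zbar f p = conjF (F.transition F') p * F.Zbar f p := by
  simp only [Zbar_apply, conjF_apply, F.Z_change F' hp, map_mul]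

theorem T_change {p : M} (hp : p ∈ F.U ∩ F'.U) (f : CF M) : F'.T f p = F.T f p := by
  have h1 := F.levi p hp.1 F'.T F.Zbar
  have h2 := F.levi p hp.1 F'.T F.Z
  rw [F'.dθ_T p hp.2, wedge_apply, F.θ1_Zbar' hp.1, F.conjθ1_Zbar hp.1] at h1
  rw [F'.dθ_T p hp.2, wedge_apply, F.θ1_Z p hp.1, F.conjθ1_Z hp.1] at h2
  have h3 : F.θ1 F'.T p = 0 := by simpa using h1
  have h4 : conjForm F.θ1 F'.T p = 0 := by simpa using h2
  rw [F.expand hp.1 F'.T f, h3, h4, F'.θ_T p hp.2]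
  ring

/-- Both frames are normalized by `dθ(Z_1, Z_{\bar 1}) = i`, so the transition function is
unimodular. -/
theorem transition_mul_conj {p : M} (hp : p ∈ F.U ∩ F'.U) :
    F.transition F' p * conjF (F.transition F') p = 1 := by
  have h1 := F'.levi p hp.2 F'.Z F'.Zbar
  have h2 := F.levi p hp.1 F'.Z F'.Zbar
  rw [wedge_apply, F'.θ1_Z p hp.2, F'.θ1_Zbar' hp.2, F'.conjθ1_Zbar hp.2] at h1
  have h3 : F.θ1 F'.Zbar p = 0 := by
    have := F.conjForm_θ1_eq_zero F'.Z_mem hp.1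
    rwa [conjForm_apply, conjF_apply, map_eq_zero] at this
  have h4 : conjForm F.θ1 F'.Zbar p = conjF (F.transition F') p := by
    rw [conjForm_apply, conjV_Zbar]
    rfl
  rw [wedge_apply, h3, h4] at h2
  change _ = Complex.I * (F.transition F' p * _ - _) at h2
  refine mul_left_cancel₀ Complex.I_ne_zero ?_
  linear_combination h1 - h2

theorem θ1_change {p : M} (hp : p ∈ F.U ∩ F'.U) (V : Vec M) :
    F'.θ1 V p = conjF (F.transition F') p * F.θ1 V p := by
  have hu := F.transition_mul_conj F' hp
  have hT : F'.θ1 F.T p = 0 := by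
    rw [form_congr_at F'.θ1 (fun f => (F.T_change F' hp f).symm), F'.θ1_T p hp.2]
  have hZ : F.transition F' p * F'.θ1 F.Z p = 1 := by
    rw [← F'.θ1_Z p hp.2, form_congr_at F'.θ1 (W := F.transition F' • F.Z) (F.Z_change F' hp)]
    simp
  have hZb : conjF (F.transition F') p * F'.θ1 F.Zbar p = 0 := by
    rw [← F'.θ1_Zbar' hp.2,
      form_congr_at F'.θ1 (W := conjF (F.transition F') • F.Zbar) (F.Zbar_change F' hp)]
    simp
  rw [F.form_expand hp.1 F'.θ1 V, hT]
  linear_combination (-F.θ1 V p * F'.θ1 F.Z p - conjForm F.θ1 V p * F'.θ1 F.Zbar p) * hu +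
    F.θ1 V p * conjF (F.transition F') p * hZ +
    conjForm F.θ1 V p * F.transition F' p * hZb

theorem conjθ1_change {p : M} (hp : p ∈ F.U ∩ F'.U) (V : Vec M) :
    conjForm F'.θ1 V p = F.transition F' p * conjForm F.θ1 V p := by
  simp only [conjForm_apply, conjF_apply, F.θ1_change F' hp, map_mul, Complex.conj_conj]

/-- `conn F.Zbar` is minus the `θ^1`-component of `⁅Z_1, Z_{\bar 1}⁆`; the bracket of `u Z_1` and
`conj u Z_{\bar 1}` is expanded by the Leibniz rule. -/
theorem conn_Zbar_change {p : M} (hp : p ∈ F.U ∩ F'.U) :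
    F'.conn F'.Zbar p = conjF (F.transition F') p *
      (F.conn F.Zbar p + conjF (F.transition F') p * F.Zbar (F.transition F') p) := by
  set u := F.transition F' with hu
  have h : ∀ f, ⁅F'.Z, F'.Zbar⁆ f p = ((u * conjF u) • ⁅F.Z, F.Zbar⁆ + (u * F.Z (conjF u)) • F.Zbar
      + (-(conjF u * F.Zbar u)) • F.Z) f p := fun f => by
    have h1 : ∀ q ∈ F.U ∩ F'.U, F'.Zbar f q = (conjF u * F.Zbar f) q :=
      fun q hq => F.Zbar_change F' hq f
    have h2 : ∀ q ∈ F.U ∩ F'.U, F'.Z f q = (u * F.Z f) q := fun q hq => F.Z_change F' hq f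
    simp only [Derivation.commutator_apply, CF.sub_apply, Derivation.add_apply, CF.add_apply,
      Derivation.smul_apply, smul_eq_mul, CF.mul_apply, CF.neg_apply]
    rw [F.Z_change F' hp, F.Zbar_change F' hp, F.Z.congr_on (F.isOpen_inter F') h1 hp,
      F.Zbar.congr_on (F.isOpen_inter F') h2 hp]
    simp only [Derivation.leibniz, CF.add_apply, smul_eq_mul, CF.mul_apply, ← hu]
    ring
  have h3 := F'.θ1_lie_Z_Zbar hp.2
  rw [form_congr_at F'.θ1 h, F.θ1_change F' hp] at h3
  simp only [map_add, map_smul, CF.add_apply, smul_eq_mul, CF.mul_apply, CF.neg_apply,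
    F.θ1_lie_Z_Zbar hp.1, F.θ1_Z p hp.1, F.θ1_Zbar' hp.1] at h3
  have h4 := F.transition_mul_conj F' hp
  rw [← hu] at h3 h4
  linear_combination h3 + conjF u p * F.conn F.Zbar p * h4

theorem conn_Z_change {p : M} (hp : p ∈ F.U ∩ F'.U) :
    F'.conn F'.Z p = F.transition F' p *
      (F.conn F.Z p - F.transition F' p * F.Z (conjF (F.transition F')) p) := by
  have h := F'.conj_conn_Zbar hp.2
  rw [F.conn_Zbar_change F' hp, map_mul, map_add, map_mul, F.conj_conn_Zbar hp.1, conjF_apply,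
    Complex.conj_conj, ← conjF_apply (F.Zbar _), conjF_Zbar] at h
  linear_combination h

theorem A11_change {p : M} (hp : p ∈ F.U ∩ F'.U) :
    F'.A11 p = F.transition F' p * F.transition F' p * F.A11 p := by
  set u := F.transition F' with hu
  have h : ∀ f, ⁅F'.T, F'.Zbar⁆ f p =
      (conjF u • ⁅F.T, F.Zbar⁆ + F.T (conjF u) • F.Zbar) f p := fun f => by
    have h1 : ∀ q ∈ F.U ∩ F'.U, F'.Zbar f q = (conjF u * F.Zbar f) q :=
      fun q hq => F.Zbar_change F' hq f
    have h2 : ∀ q ∈ F.U ∩ F'.U, F'.T f q = F.T f q := fun q hq => F.T_change F' hq f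
    simp only [Derivation.commutator_apply, CF.sub_apply, Derivation.add_apply, CF.add_apply,
      Derivation.smul_apply, smul_eq_mul, CF.mul_apply]
    rw [F.T_change F' hp, F.Zbar_change F' hp, F.T.congr_on (F.isOpen_inter F') h1 hp,
      F.Zbar.congr_on (F.isOpen_inter F') h2 hp]
    simp only [Derivation.leibniz, CF.add_apply, smul_eq_mul, CF.mul_apply, ← hu]
    ring
  have h3 := F'.θ1_lie_T_Zbar hp.2
  rw [form_congr_at F'.θ1 h, F.θ1_change F' hp] at h3
  simp only [map_add, map_smul, CF.add_apply, smul_eq_mul, CF.mul_apply,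
    F.θ1_lie_T_Zbar hp.1, F.θ1_Zbar' hp.1, ← hu] at h3
  have h4 : F'.torsion p = conjF u p * conjF u p * F.torsion p := by linear_combination h3
  simp only [A11, conjF_apply, h4, map_mul, Complex.conj_conj]

/-- `f_{\bar 1 1}` does not depend on the frame (step `h2`), since `u conj u = 1`, so
differentiating it along `Z_1'` contributes one `u`. The torsion term scales by `u · u · conj u =
u`. -/
theorem coeff_change {p : M} (hp : p ∈ F.U ∩ F'.U) (f : CF M) :
    F'.coeff f p = F.transition F' p * F.coeff f p := by
  set u := F.transition F' with hu
  have h1 : ∀ q ∈ F.U ∩ F'.U, F'.Zbar f q = (conjF u * F.Zbar f) q :=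
    fun q hq => F.Zbar_change F' hq f
  have h2 : ∀ q ∈ F.U ∩ F'.U, (F'.Z (F'.Zbar f) + F'.conn F'.Z * F'.Zbar f) q =
      (F.Z (F.Zbar f) + F.conn F.Z * F.Zbar f) q := fun q hq => by
    have h3 := F.transition_mul_conj F' hq
    simp only [CF.add_apply, CF.mul_apply]
    rw [F.Z_change F' hq, F.Z.congr_on (F.isOpen_inter F') h1 hq, h1 q hq,
      F.conn_Z_change F' hq]
    simp only [Derivation.leibniz, CF.add_apply, smul_eq_mul, CF.mul_apply, ← hu] at h3 ⊢
    linear_combination (F.Z (F.Zbar f) q + F.conn F.Z q * F.Zbar f q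
      - u q * F.Z (conjF u) q * F.Zbar f q) * h3
  have h3 := F.transition_mul_conj F' hp
  rw [F'.coeff_apply hp.2, F.coeff_apply hp.1, F.Z_change F' hp,
    F.Z.congr_on (F.isOpen_inter F') h2 hp, F.A11_change F' hp, h1 p hp]
  simp only [CF.mul_apply, ← hu] at h3 ⊢
  linear_combination (Complex.I * u p * F.A11 p * F.Zbar f p) * h3

/-- The form `P_3 f` does not depend on the frame. -/
theorem coeff_mul_θ1_change {p : M} (hp : p ∈ F.U ∩ F'.U) (f : CF M) (V : Vec M) :
    F'.coeff f p * F'.θ1 V p = F.coeff f p * F.θ1 V p := by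
  rw [F.coeff_change F' hp, F.θ1_change F' hp]
  linear_combination (F.coeff f p * F.θ1 V p) * F.transition_mul_conj F' hp

/-- The form `d'' f` does not depend on the frame. -/
theorem Zbar_mul_conjθ1_change {p : M} (hp : p ∈ F.U ∩ F'.U) (f : CF M) (V : Vec M) :
    F'.Zbar f p * conjForm F'.θ1 V p = F.Zbar f p * conjForm F.θ1 V p := by
  rw [F.Zbar_change F' hp, F.conjθ1_change F' hp]
  linear_combination (F.Zbar f p * conjForm F.θ1 V p) * F.transition_mul_conj F' hp

end LocalFrame

end Pseudohermitian

end FrameChange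

/-! ### Existence of local frames -/

section FrameExistence

variable {M : Type*} [TopologicalSpace M] [ChartedSpace (EuclideanSpace ℝ (Fin 3)) M]
  [T2Space M] [IsManifold (𝓡 3) ∞ M]

theorem dForm_expand_at {p : M} {a b c : Form1 M} {A B C : Vec M}
    (h : ∀ (V : Vec M) (f : CF M), V f p = a V p * A f p + b V p * B f p + c V p * C f p)
    (α : Form1 M) (V W : Vec M) : dForm α V W p = wedge a b V W p * dForm α A B p +
      wedge a c V W p * dForm α A C p + wedge b c V W p * dForm α B C p := by
  have h1 : ∀ X Y : Vec M, dForm α X Y p =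
      a Y p * dForm α X A p + b Y p * dForm α X B p + c Y p * dForm α X C p := fun X Y =>
    form_expand_at h (extDeriv α X) Y
  have h2 : ∀ X Y : Vec M, dForm α X Y p = -dForm α Y X p := fun X Y => by
    rw [dForm_swap α Y X, CF.neg_apply]
  rw [h1 V W, h2 V A, h2 V B, h2 V C, h1 A V, h1 B V, h1 C V, h2 B A, h2 C A, h2 C B,
    dForm_self, dForm_self, dForm_self, wedge_apply, wedge_apply, wedge_apply, CF.zero_apply]
  ring

namespace Pseudohermitian

variable (S : Pseudohermitian M)

theorem exists_ker_ne_zero (p : M) : ∃ V : Vec M, S.θ V = 0 ∧ ∃ g, V g p ≠ 0 := by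
  obtain ⟨C⟩ := nonempty_chartFrame p
  obtain ⟨V, hV⟩ := S.θ_ne_zero p
  obtain ⟨j, hj⟩ : ∃ j, S.θ (C.X j) p ≠ 0 := by
    by_contra! hcon
    exact hV (by rw [C.form_expand C.mem]; simp [hcon])
  obtain ⟨i, hij⟩ := exists_ne j
  refine ⟨S.θ (C.X j) • C.X i - S.θ (C.X i) • C.X j, ?_, C.x i, ?_⟩
  · rw [map_sub, map_smul, map_smul, smul_eq_mul, smul_eq_mul]
    ring
  · simpa [C.X_x p C.mem, hij.symm] using hj

/-- For `V` in `ξ ⊗ ℂ` not zero at `p`, the fields `V - i J V` and `conj V - i J (conj V)` are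
sections of `T_{1,0}`. The first plus the conjugate of the second is `2 V`, so one of them is
nonzero at `p`. -/
theorem exists_T10_ne_zero (p : M) : ∃ Z ∈ S.T10, ∃ g, Z g p ≠ 0 := by
  obtain ⟨V, hV, g, hg⟩ := S.exists_ker_ne_zero p
  have hVc : S.θ (conjV V) = 0 := by rw [S.θ_conjV, hV, map_zero]
  by_contra! hcon
  have h1 := hcon _ (S.sub_I_J_mem_T10 ⟨V, hV⟩) g
  have h2 := hcon _ (S.sub_I_J_mem_T10 ⟨conjV V, hVc⟩) (conjF g)
  have h3 := S.J_real ⟨V, hV⟩ ⟨conjV V, hVc⟩ rfl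
  simp only [Submodule.coe_sub, Submodule.coe_smul, Derivation.sub_apply, Derivation.smul_apply,
    smul_eq_mul, CF.sub_apply, CF.mul_apply, CF.algebraMap_apply, h3] at h1 h2
  rw [conjV_apply, conjV_apply, conjF_conjF, conjF_apply, conjF_apply] at h2
  have h4 := congrArg (starRingEnd ℂ) h2
  simp only [map_sub, map_mul, Complex.conj_conj, Complex.conj_I, map_zero] at h4
  apply hg
  linear_combination (h1 + h4) / 2

/-- Near every point there is a section of `T_{1,0}` with `h_{1\bar 1} = 1`. -/
theorem exists_T10_normalized (p : M) : ∃ Z ∈ S.T10, ∀ᶠ q in 𝓝 p,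
    dForm S.θ Z (conjV Z) q = Complex.I := by
  obtain ⟨Z, hZ, hg⟩ := S.exists_T10_ne_zero p
  obtain ⟨hθ, hJ⟩ := S.mem_T10_iff.1 hZ
  set L : CF M := (-Complex.I) • dForm S.θ Z (conjV Z) with hL
  have hpos : 0 < (L p).re := S.levi_pos ⟨Z, hθ⟩ hJ p hg
  have hLr : ∀ q, ((L q).re : ℂ) = L q := fun q => by
    have := congrArg (fun f : CF M => f q) (S.conjF_levi Z)
    exact Complex.conj_eq_iff_re.1 this
  have hcont : Continuous fun q => (L q).re := Complex.continuous_re.comp L.contMDiff.continuous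
  have hev : ∀ᶠ q in 𝓝 p, 0 < (L q).re := hcont.continuousAt.eventually (lt_mem_nhds hpos)
  -- Scaling `Z` by `L^{-1/2}` divides the Levi form by `L`.
  have hsm : ContDiffOn ℝ ∞ (fun z : ℂ => (((Real.sqrt z.re)⁻¹ : ℝ) : ℂ)) {z | 0 < z.re} := by
    intro z hz
    have h1 : ContDiffAt ℝ ∞ (fun z : ℂ => Real.sqrt z.re) z :=
      ContDiffAt.sqrt Complex.reCLM.contDiff.contDiffAt (ne_of_gt hz)
    exact (Complex.ofRealCLM.contDiff.contDiffAt.comp z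
      (h1.inv (Real.sqrt_pos.2 hz).ne')).contDiffWithinAt
  obtain ⟨r, hr⟩ := exists_eventually_eq_of_contMDiffOn hev
    (hsm.contMDiffOn.comp L.contMDiff.contMDiffOn fun q hq => hq)
  refine ⟨r • Z, S.T10.smul_mem r hZ, ?_⟩
  filter_upwards [hr, hev] with q h1 h2
  have h3 : r q * conjF r q * L q = 1 := by
    have h4 : ((Real.sqrt (L q).re : ℝ) : ℂ) * (Real.sqrt (L q).re : ℝ) = L q := by
      rw [← Complex.ofReal_mul, Real.mul_self_sqrt h2.le, hLr]
    have h5 : ((Real.sqrt (L q).re : ℝ) : ℂ) ≠ 0 :=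
      Complex.ofReal_ne_zero.2 (Real.sqrt_pos.2 h2).ne'
    rw [conjF_apply, h1, Function.comp_apply, Complex.conj_ofReal, Complex.ofReal_inv]
    nth_rw 3 [← h4]
    field_simp
  rw [conjV_smul, ← extDeriv_apply, map_smul, map_smul, LinearMap.smul_apply, extDeriv_apply]
  simp only [hL, smul_eq_mul, CF.mul_apply, CF.smul_apply] at h3 ⊢
  linear_combination Complex.I * h3 +
    (r q * conjF r q * dForm S.θ Z (conjV Z) q) * Complex.I_mul_I

theorem exists_θ_eq_one (p : M) : ∃ V : Vec M, ∀ᶠ q in 𝓝 p, S.θ V q = 1 := by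
  obtain ⟨V, hV⟩ := S.θ_ne_zero p
  have hev : ∀ᶠ q in 𝓝 p, S.θ V q ≠ 0 :=
    (S.θ V).contMDiff.continuous.continuousAt.eventually_ne hV
  have hsm : ContDiffOn ℝ ∞ (fun z : ℂ => z⁻¹) {z | z ≠ 0} := fun z hz =>
    (contDiffAt_inv ℝ hz).contDiffWithinAt
  obtain ⟨r, hr⟩ := exists_eventually_eq_of_contMDiffOn hev
    (hsm.contMDiffOn.comp (S.θ V).contMDiff.contMDiffOn fun q hq => hq)
  refine ⟨r • V, ?_⟩
  filter_upwards [hr, hev] with q h1 h2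
  rw [map_smul, smul_eq_mul, CF.mul_apply, h1]
  exact inv_mul_cancel₀ h2

/-- Local frames exist. -/
theorem exists_localFrame (p : M) : ∃ F : S.LocalFrame, p ∈ F.U := by
  obtain ⟨Z, hZ, hZn⟩ := S.exists_T10_normalized p
  obtain ⟨V, hV⟩ := S.exists_θ_eq_one p
  obtain ⟨U, hU, hUo, hpU⟩ := mem_nhds_iff.1 (hZn.and hV)
  have hθZ := S.θ_eq_zero hZ
  have hθZb := S.θ_conjV_eq_zero hZ
  have hZZb : ∀ q ∈ U, dForm S.θ Z (conjV Z) q = Complex.I := fun q hq => (hU hq).1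
  have hZbZ : ∀ q ∈ U, dForm S.θ (conjV Z) Z q = -Complex.I := fun q hq => by
    rw [dForm_swap, CF.neg_apply, hZZb q hq]
  -- Adding multiples of `Z` and `conj Z` leaves `θ(V) = 1` unchanged; these coefficients cancel
  -- `dθ(V, Z)` and `dθ(V, conj Z)`.
  let T : Vec M := V + (Complex.I • dForm S.θ V (conjV Z)) • Z +
    (-(Complex.I • dForm S.θ V Z)) • conjV Z
  have hθT : ∀ q ∈ U, S.θ T q = 1 := fun q hq => by
    simp only [T, map_add, map_smul, hθZ, hθZb, smul_zero, add_zero]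
    exact (hU hq).2
  have hTW : ∀ W q, dForm S.θ T W q = dForm S.θ V W q +
      Complex.I * dForm S.θ V (conjV Z) q * dForm S.θ Z W q +
      -(Complex.I * dForm S.θ V Z q) * dForm S.θ (conjV Z) W q := fun W q => by
    simp only [T, dForm_add_left, dForm_smul_left, CF.add_apply, CF.mul_apply, CF.smul_apply,
      CF.neg_apply]
  have hTZ : ∀ q ∈ U, dForm S.θ T Z q = 0 := fun q hq => by
    rw [hTW, dForm_self, hZbZ q hq, CF.zero_apply]
    linear_combination dForm S.θ V Z q * Complex.I_mul_I
  have hTZb : ∀ q ∈ U, dForm S.θ T (conjV Z) q = 0 := fun q hq => by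
    rw [hTW, dForm_self, hZZb q hq, CF.zero_apply]
    linear_combination dForm S.θ V (conjV Z) q * Complex.I_mul_I
  -- Forced by `dθ = i θ^1 ∧ θ^{\bar 1}` evaluated on `(W, conj Z)`.
  let θ1 : Form1 M := (-Complex.I) • (extDeriv S.θ).flip (conjV Z)
  have hθ1 : ∀ W q, θ1 W q = -Complex.I * dForm S.θ W (conjV Z) q := fun W q => rfl
  have hcθ1 : ∀ W q, conjForm θ1 W q = Complex.I * dForm S.θ W Z q := fun W q => by
    rw [conjForm_apply, conjF_apply, hθ1, S.dForm_θ_conjV, conjF_apply, map_mul, Complex.conj_conj,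
      map_neg, Complex.conj_I, neg_neg]
  have h1T : ∀ q ∈ U, θ1 T q = 0 := fun q hq => by rw [hθ1, hTZb q hq, mul_zero]
  have h1Z : ∀ q ∈ U, θ1 Z q = 1 := fun q hq => by
    rw [hθ1, hZZb q hq, neg_mul, Complex.I_mul_I, neg_neg]
  have h1Zb : ∀ q ∈ U, θ1 (conjV Z) q = 0 := fun q hq => by
    rw [hθ1, dForm_self, CF.zero_apply, mul_zero]
  have hcT : ∀ q ∈ U, conjForm θ1 T q = 0 := fun q hq => by rw [hcθ1, hTZ q hq, mul_zero]
  have hcZ : ∀ q ∈ U, conjForm θ1 Z q = 0 := fun q hq => by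
    rw [hcθ1, dForm_self, CF.zero_apply, mul_zero]
  have hcZb : ∀ q ∈ U, conjForm θ1 (conjV Z) q = 1 := fun q hq => by
    rw [hcθ1, hZbZ q hq, mul_neg, Complex.I_mul_I, neg_neg]
  have hexp : ∀ q ∈ U, ∀ (W : Vec M) (f : CF M), W f q =
      S.θ W q * T f q + θ1 W q * Z f q + conjForm θ1 W q * conjV Z f q := fun q hq W f => by
    have h := expand_of_dual (p := q) ![S.θ, θ1, conjForm θ1] ![T, Z, conjV Z] (by
      intro i j
      fin_cases i <;> fin_cases j <;>
        simp [hθT q hq, h1T q hq, h1Z q hq, h1Zb q hq, hcT q hq, hcZ q hq, hcZb q hq,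
          hθZ, hθZb]) W f
    simpa [Fin.sum_univ_three] using h
  have hdT : ∀ q ∈ U, ∀ W, dForm S.θ T W q = 0 := fun q hq W => by
    rw [dForm_expand_at (hexp q hq), hTZ q hq, hTZb q hq, wedge_apply θ1, h1T q hq, hcT q hq]
    ring
  have hTr : ∀ q ∈ U, ∀ f, conjV T f q = T f q := fun q hq f => by
    have h1 : θ1 (conjV T) q = 0 := by
      have := hcT q hq
      rwa [conjForm_apply, conjF_apply, map_eq_zero] at this
    rw [hexp q hq, S.θ_conjV, conjF_apply, hθT q hq, h1, conjForm_apply, conjV_conjV,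
      conjF_apply, h1T q hq]
    simp
  -- The structure equation on `(Z, conj Z)` and on `(T, Z)` forces `conn (conj Z) = cb` and `conn T
  -- = cT`; skewness then forces `conn Z = -conj cb`.
  let cb : CF M := -θ1 ⁅Z, conjV Z⁆
  let cT : CF M := θ1 ⁅T, Z⁆
  -- Skewness in the direction `T` leaves no freedom; it follows from `d(dθ) = 0` on `(T, Z, conj
  -- Z)`.
  have hcTr : ∀ q ∈ U, cT q + conjF cT q = 0 := fun q hq => by
    have h1 : ∀ f, ⁅conjV T, conjV Z⁆ f q = ⁅T, conjV Z⁆ f q := fun f => by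
      simp only [Derivation.commutator_apply, CF.sub_apply, hTr q hq]
      rw [(conjV Z).congr_on hUo (fun q hq => hTr q hq f) hq]
    have h2 : conjF cT q = Complex.I * dForm S.θ ⁅T, conjV Z⁆ Z q := by
      rw [← hcθ1, ← form_congr_at (conjForm θ1) h1, ← conjV_lie, conjForm_apply, conjV_conjV]
    have h3 := congrArg (fun f : CF M => f q) (dForm_cyclic S.θ T Z (conjV Z))
    simp only [CF.sub_apply, CF.add_apply, CF.zero_apply] at h3
    rw [T.apply_eq_zero_of_const hUo hZZb hq, Z.apply_eq_zero_of_const hUo hTZb hq,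
      (conjV Z).apply_eq_zero_of_const hUo hTZ hq, dForm_swap S.θ T ⁅Z, conjV Z⁆, CF.neg_apply,
      hdT q hq] at h3
    rw [h2]
    change -Complex.I * dForm S.θ ⁅T, Z⁆ (conjV Z) q + _ = 0
    linear_combination Complex.I * h3
  let conn : Form1 M := (-conjF cb) • θ1 + cb • conjForm θ1 + cT • S.θ
  have hconn : ∀ W q, conn W q =
      -conjF cb q * θ1 W q + cb q * conjForm θ1 W q + cT q * S.θ W q := fun W q => rfl
  have hd : ∀ {X Y : Vec M} {a b : ℂ}, (∀ q ∈ U, θ1 X q = a) → (∀ q ∈ U, θ1 Y q = b) →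
      ∀ q ∈ U, dForm θ1 X Y q = -θ1 ⁅X, Y⁆ q := by
    intro X Y a b hX hY q hq
    simp only [dForm, CF.sub_apply, X.apply_eq_zero_of_const hUo hY hq,
      Y.apply_eq_zero_of_const hUo hX hq]
    ring
  refine ⟨⟨U, hUo, T, Z, θ1, conn, -θ1 ⁅T, conjV Z⁆, hZ, hθT, hdT, h1T, h1Z, h1Zb, ?_, ?_, ?_⟩, hpU⟩
  · intro q hq X Y
    rw [dForm_expand_at (hexp q hq), hTZ q hq, hTZb q hq, hZZb q hq]
    ring
  · intro q hq X Y
    rw [dForm_expand_at (hexp q hq), hd h1T h1Z q hq, hd h1T h1Zb q hq, hd h1Z h1Zb q hq]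
    simp only [wedge_apply, hconn, CF.neg_apply, cb, cT]
    ring
  · intro q hq X
    have h1 := hcTr q hq
    rw [conjF_apply] at h1
    rw [CF.add_apply, conjForm_apply, conjF_apply, hconn, hconn, S.θ_conjV, conjForm_apply θ1 X,
      conjForm_apply θ1 (conjV X), conjV_conjV]
    simp only [conjF_apply, map_add, map_mul, map_neg, Complex.conj_conj]
    linear_combination S.θ X q * h1

end Pseudohermitian

end FrameExistence

/-! ### The operators in local frames -/

section Operators

variable {M : Type*} [TopologicalSpace M] [ChartedSpace (EuclideanSpace ℝ (Fin 3)) M]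

namespace Pseudohermitian

variable (S : Pseudohermitian M)

namespace LocalFrame

variable {S} (F : S.LocalFrame)

/-- For a real function `f`, the form `i (f_{\bar 1} θ^{\bar 1} - f_1 θ^1) + l θ` whose
primitives `g` are the functions with `f + i g` CR holomorphic. -/
def conjugateForm (f : CF M) : Form1 M :=
  (Complex.I • F.Zbar f) • conjForm F.θ1 + (-(Complex.I • F.Z f)) • F.θ1 +
    (-((2 : ℂ) • (F.Z (F.Zbar f) + F.conn F.Z * F.Zbar f) + Complex.I • F.T f)) • S.θ

theorem conjugateForm_apply (f : CF M) (V : Vec M) (p : M) :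
    F.conjugateForm f V p = Complex.I * F.Zbar f p * conjForm F.θ1 V p +
      -(Complex.I * F.Z f p) * F.θ1 V p + -(2 * (F.Z (F.Zbar f) p + F.conn F.Z p * F.Zbar f p) +
        Complex.I * F.T f p) * S.θ V p := rfl

theorem conjugateForm_Z {p : M} (hp : p ∈ F.U) (f : CF M) :
    F.conjugateForm f F.Z p = (-(Complex.I • F.Z f)) p := by
  rw [conjugateForm_apply, F.conjθ1_Z hp, F.θ1_Z p hp, F.θ_Z, CF.zero_apply, CF.neg_apply,
    CF.smul_apply]
  ring

theorem conjugateForm_Zbar {p : M} (hp : p ∈ F.U) (f : CF M) :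
    F.conjugateForm f F.Zbar p = (Complex.I • F.Zbar f) p := by
  rw [conjugateForm_apply, F.conjθ1_Zbar hp, F.θ1_Zbar' hp, F.θ_Zbar, CF.zero_apply, CF.smul_apply]
  ring

theorem conjugateForm_T {p : M} (hp : p ∈ F.U) (f : CF M) : F.conjugateForm f F.T p =
    (-((2 : ℂ) • (F.Z (F.Zbar f) + F.conn F.Z * F.Zbar f) + Complex.I • F.T f)) p := by
  rw [conjugateForm_apply, F.conjθ1_T hp, F.θ1_T p hp, F.θ_T p hp]
  simp only [CF.neg_apply, CF.add_apply, CF.smul_apply, CF.mul_apply]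
  ring

end LocalFrame

theorem mem_P3_iff {f : CF M} {σ : Form1 M} : (f, σ) ∈ S.P3 ↔
    ∀ F : S.LocalFrame, ∀ p ∈ F.U, ∀ V, σ V p = F.coeff f p * F.θ1 V p := by
  constructor
  · rintro ⟨h1, h2⟩ F p hp V
    rw [h1 F p hp V, h2 F p hp]
    rfl
  · intro h
    have h2 : ∀ F : S.LocalFrame, ∀ p ∈ F.U, σ F.Z p = F.coeff f p := fun F p hp => by
      rw [h F p hp, F.θ1_Z p hp, mul_one]
    refine ⟨fun F p hp V => ?_, fun F p hp => h2 F p hp⟩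
    rw [h2 F p hp, h F p hp V]

theorem mem_dbar_iff {f : CF M} {σ : Form1 M} : (f, σ) ∈ S.dbar ↔
    ∀ F : S.LocalFrame, ∀ p ∈ F.U, ∀ V, σ V p = F.Zbar f p * conjForm F.θ1 V p := by
  constructor
  · rintro ⟨h1, h2⟩ F p hp V
    rw [h1 F p hp V, h2 F p hp]
  · intro h
    have h2 : ∀ F : S.LocalFrame, ∀ p ∈ F.U, σ F.Zbar p = F.Zbar f p := fun F p hp => by
      rw [h F p hp, F.conjθ1_Zbar hp, mul_one]
    refine ⟨fun F p hp V => ?_, fun F p hp => h2 F p hp⟩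
    rw [h2 F p hp, h F p hp V]

theorem wedge_Z_T {F : S.LocalFrame} {p : M} (hp : p ∈ F.U) : wedge F.θ1 S.θ F.Z F.T p = 1 := by
  rw [wedge_apply, F.θ1_Z p hp, F.θ_T p hp, F.θ_Z, CF.zero_apply]
  ring

theorem conjF_eq_self {f : CF M} (hf : f ∈ realFunctions M) : conjF f = f := by
  ext q
  exact Complex.conj_eq_iff_im.2 (hf q)

theorem pluriharmonic_le_real : S.pluriharmonic ≤ realFunctions M := fun f hf p => by
  obtain ⟨U, -, hpU, H, -, hfH⟩ := hf p
  rw [hfH p hpU, Complex.ofReal_im]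

variable [T2Space M] [IsManifold (𝓡 3) ∞ M]

/-- A family of forms, one for each local frame, that agree on overlaps defines a global form. -/
theorem exists_glued_form (G : S.LocalFrame → Form1 M)
    (hG : ∀ F F' : S.LocalFrame, ∀ p ∈ F.U ∩ F'.U, ∀ V, G F' V p = G F V p) :
    ∃ σ : Form1 M, ∀ F : S.LocalFrame, ∀ p ∈ F.U, ∀ V, σ V p = G F V p := by
  -- The value at `q` is taken in the frame chosen at `q`; near `p` it agrees with the smooth
  -- function given by the single frame `Φ p`.
  choose Φ hΦ using S.exists_localFrame
  refine ⟨{ toFun := fun V => ⟨fun q => G (Φ q) V q, fun p => ?_⟩, map_add' := fun V W => ?_,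
            map_smul' := fun b V => ?_ }, fun F p hp V => hG F (Φ p) p ⟨hp, hΦ p⟩ V⟩
  · refine (G (Φ p) V).contMDiff.contMDiffAt.congr_of_eventuallyEq ?_
    filter_upwards [(Φ p).isOpen.mem_nhds (hΦ p)] with q hq
    exact hG (Φ p) (Φ q) q ⟨hq, hΦ q⟩ V
  · ext q
    change G (Φ q) (V + W) q = G (Φ q) V q + G (Φ q) W q
    rw [map_add, CF.add_apply]
  · ext q
    change G (Φ q) (b • V) q = b q * G (Φ q) V q
    rw [map_smul, smul_eq_mul, CF.mul_apply]

theorem exists_mem_P3 (f : CF M) : ∃ σ, (f, σ) ∈ S.P3 := by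
  obtain ⟨σ, hσ⟩ := S.exists_glued_form (fun F => F.coeff f • F.θ1) fun F F' p hp V =>
    F.coeff_mul_θ1_change F' hp f V
  exact ⟨σ, S.mem_P3_iff.2 hσ⟩

theorem exists_mem_dbar (f : CF M) : ∃ σ, (f, σ) ∈ S.dbar := by
  obtain ⟨σ, hσ⟩ := S.exists_glued_form (fun F => F.Zbar f • conjForm F.θ1) fun F F' p hp V =>
    F.Zbar_mul_conjθ1_change F' hp f V
  exact ⟨σ, S.mem_dbar_iff.2 hσ⟩

/-- Two-forms that agree at the points of all local frames are equal. -/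
theorem form2_ext {η η' : Form2 M}
    (h : ∀ F : S.LocalFrame, ∀ p ∈ F.U, ∀ V W, η V W p = η' V W p) : η = η' := by
  ext V W p
  obtain ⟨F, hp⟩ := S.exists_localFrame p
  exact h F p hp V W

theorem mem_P3F20_iff {f : CF M} {η : Form2 M} : (f, η) ∈ S.P3F20 ↔
    ∀ F : S.LocalFrame, ∀ p ∈ F.U, ∀ V W, η V W p = F.coeff f p * wedge F.θ1 S.θ V W p := by
  have key : ∀ σ, (f, σ) ∈ S.P3 → ∀ F : S.LocalFrame, ∀ p ∈ F.U, ∀ V W,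
      wedge σ S.θ V W p = F.coeff f p * wedge F.θ1 S.θ V W p := fun σ hσ F p hp V W => by
    rw [wedge_apply, wedge_apply, S.mem_P3_iff.1 hσ F p hp, S.mem_P3_iff.1 hσ F p hp]
    ring
  constructor
  · rintro ⟨σ, hσ, h⟩
    have hη : η = wedge σ S.θ := h
    rw [hη]
    exact key σ hσ
  · intro h
    obtain ⟨σ, hσ⟩ := S.exists_mem_P3 f
    refine ⟨σ, hσ, S.form2_ext fun F p hp V W => ?_⟩
    rw [h F p hp]
    exact (key σ hσ F p hp V W).symm

theorem exists_mem_P3F20 (f : CF M) : ∃ η, (f, η) ∈ S.P3F20 := by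
  obtain ⟨σ, hσ⟩ := S.exists_mem_P3 f
  exact ⟨S.wedgeθ σ, σ, hσ, rfl⟩

theorem existsUnique_mem_P3F20 (f : CF M) : ∃! η, (f, η) ∈ S.P3F20 := by
  obtain ⟨η, hη⟩ := S.exists_mem_P3F20 f
  refine ⟨η, hη, fun η' hη' => S.form2_ext fun F p hp V W => ?_⟩
  rw [S.mem_P3F20_iff.1 hη F p hp, S.mem_P3F20_iff.1 hη' F p hp]

/-- `i f_{\bar 1 1 1} - A_{11} f_{\bar 1} = i (f_{\bar 1 1 1} + i A_{11} f_{\bar 1})`. -/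
theorem mem_DplusDbar_iff {f : CF M} {η : Form2 M} : (f, η) ∈ S.DplusDbar ↔
    ∀ F : S.LocalFrame, ∀ p ∈ F.U, ∀ V W,
      η V W p = Complex.I * F.coeff f p * wedge F.θ1 S.θ V W p := by
  have key : ∀ σ, (f, σ) ∈ S.dbar → ∀ F : S.LocalFrame, ∀ p ∈ F.U,
      (Complex.I • F.cbar11 (σ F.Zbar) - F.A11 * σ F.Zbar) p = Complex.I * F.coeff f p := by
    intro σ hσ F p hp
    rw [CF.sub_apply, CF.smul_apply, CF.mul_apply, F.cbar11_congr (hσ.2 F) hp, hσ.2 F p hp]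
    simp only [LocalFrame.coeff, CF.add_apply, CF.smul_apply, CF.mul_apply]
    linear_combination (-F.A11 p * F.Zbar f p) * Complex.I_mul_I
  constructor
  · rintro ⟨σ, hσ, -, h2, h3⟩ F p hp V W
    rw [h2 F p hp V W]
    congr 1
    rw [← key σ hσ F p hp]
    exact h3 F p hp
  · intro h
    obtain ⟨σ, hσ⟩ := S.exists_mem_dbar f
    have h2 : ∀ F : S.LocalFrame, ∀ p ∈ F.U, η F.Z F.T p = Complex.I * F.coeff f p :=
      fun F p hp => by rw [h F p hp, S.wedge_Z_T hp, mul_one]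
    refine ⟨σ, hσ, hσ.1, fun F p hp V W => ?_, fun F p hp => ?_⟩
    · rw [h2 F p hp, h F p hp]
    · exact (h2 F p hp).trans (key σ hσ F p hp).symm

theorem mem_DplusDbar_iff_mem_P3F20 {f : CF M} {η : Form2 M} :
    (f, η) ∈ S.DplusDbar ↔ (f, -Complex.I • η) ∈ S.P3F20 := by
  rw [mem_DplusDbar_iff, mem_P3F20_iff]
  refine forall₅_congr fun F p hp V W => ?_
  rw [LinearMap.smul_apply, LinearMap.smul_apply, CF.smul_apply]
  constructor <;> intro h
  · linear_combination -Complex.I * h - F.coeff f p * wedge F.θ1 S.θ V W p * Complex.I_mul_I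
  · linear_combination Complex.I * h + η V W p * Complex.I_mul_I

theorem existsUnique_mem_DplusDbar (f : CF M) : ∃! η, (f, η) ∈ S.DplusDbar := by
  obtain ⟨η, hη, huniq⟩ := S.existsUnique_mem_P3F20 f
  have hI : -Complex.I • Complex.I • η = η := by
    rw [smul_smul, neg_mul, Complex.I_mul_I, neg_neg, one_smul]
  refine ⟨Complex.I • η, S.mem_DplusDbar_iff_mem_P3F20.2 (by rwa [hI]), fun η' hη' => ?_⟩
  rw [← huniq _ (S.mem_DplusDbar_iff_mem_P3F20.1 hη'), smul_smul, mul_neg, Complex.I_mul_I,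
    neg_neg, one_smul]

/-- The kernel of `P_3`. -/
theorem mem_P3F20_zero_iff {f : CF M} :
    (f, (0 : Form2 M)) ∈ S.P3F20 ↔ ∀ F : S.LocalFrame, ∀ p ∈ F.U, F.coeff f p = 0 := by
  rw [mem_P3F20_iff]
  constructor
  · intro h F p hp
    have := h F p hp F.Z F.T
    rw [S.wedge_Z_T hp, mul_one] at this
    exact this.symm
  · intro h F p hp V W
    rw [h F p hp, zero_mul]
    rfl

theorem mem_relKer_P3_iff {f : CF M} : f ∈ relKer S.P3 ↔ (f, (0 : Form2 M)) ∈ S.P3F20 := by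
  rw [mem_P3F20_zero_iff]
  change (f, (0 : Form1 M)) ∈ S.P3 ↔ _
  rw [mem_P3_iff]
  constructor
  · intro h F p hp
    have := h F p hp F.Z
    rw [F.θ1_Z p hp, mul_one] at this
    exact this.symm
  · intro h F p hp V
    rw [h F p hp, zero_mul]
    rfl

theorem mem_relKer_dbarF20_iff {f : CF M} {η : Form2 M} (h : (f, η) ∈ S.P3F20) :
    η ∈ relKer S.dbarF20 ↔ ∀ F : S.LocalFrame, ∀ p ∈ F.U, F.c1bar (F.coeff f) p = 0 := by
  rw [mem_P3F20_iff] at h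
  have hη : ∀ F : S.LocalFrame, ∀ p ∈ F.U, η F.Z F.T p = F.coeff f p := fun F p hp => by
    rw [h F p hp, S.wedge_Z_T hp, mul_one]
  have hc : ∀ F : S.LocalFrame, ∀ p ∈ F.U, F.c1bar (η F.Z F.T) p = F.c1bar (F.coeff f) p :=
    fun F p hp => F.c1bar_congr (hη F) hp
  constructor
  · rintro ⟨-, h2⟩ F p hp
    have h3 : 0 = Complex.I * F.c1bar (η F.Z F.T) p := h2 F p hp
    rw [← hc F p hp]
    simpa using h3.symm
  · intro h2
    refine ⟨fun F p hp V W => ?_, fun F p hp => ?_⟩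
    · change η V W p = η F.Z F.T p * _
      rw [h F p hp V W, hη F p hp]
    · change 0 = Complex.I * F.c1bar (η F.Z F.T) p
      rw [hc F p hp, h2 F p hp, mul_zero]

/-- `δ_b σ` and `d''(σ ∧ θ)` are both given by `σ_{1,\bar 1}`, up to the factor `i`. -/
theorem mem_relKer_P4_iff {f : CF M} :
    f ∈ relKer S.P4 ↔ ∃ η ∈ relKer S.dbarF20, (f, η) ∈ S.P3F20 := by
  have hc : ∀ σ, (f, σ) ∈ S.P3 → ∀ F : S.LocalFrame, ∀ p ∈ F.U,
      F.c1bar (σ F.Z) p = F.c1bar (F.coeff f) p := fun σ hσ F p hp =>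
    F.c1bar_congr (hσ.2 F) hp
  constructor
  · rintro ⟨σ, hσ, -, h2⟩
    have hη : (f, S.wedgeθ σ) ∈ S.P3F20 := ⟨σ, hσ, rfl⟩
    refine ⟨_, (S.mem_relKer_dbarF20_iff hη).2 fun F p hp => ?_, hη⟩
    rw [← hc σ hσ F p hp]
    exact (h2 F p hp).symm
  · rintro ⟨η, h1, h2⟩
    rw [S.mem_relKer_dbarF20_iff h2] at h1
    obtain ⟨σ, hσ⟩ := S.exists_mem_P3 f
    exact ⟨σ, hσ, hσ.1, fun F p hp => ((hc σ hσ F p hp).trans (h1 F p hp)).symm⟩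

end Pseudohermitian

end Operators

/-! ### CR pluriharmonic functions as the real kernel of `P_3` -/

section Pluriharmonic

variable {M : Type*} [TopologicalSpace M] [ChartedSpace (EuclideanSpace ℝ (Fin 3)) M]
  [T2Space M] [IsManifold (𝓡 3) ∞ M]

namespace ChartFrame

theorem lie_X {p : M} (C : ChartFrame p) {q : M} (hq : q ∈ C.U) (i j : Fin 3) (f : CF M) :
    ⁅C.X i, C.X j⁆ f q = 0 := by
  rw [C.expand q hq]
  refine Finset.sum_eq_zero fun k _ => ?_
  rw [Derivation.commutator_apply, CF.sub_apply,
    (C.X i).apply_eq_zero_of_const C.isOpen (fun q hq => C.X_x q hq j k) hq,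
    (C.X j).apply_eq_zero_of_const C.isOpen (fun q hq => C.X_x q hq i k) hq, sub_zero, zero_mul]

end ChartFrame

/-- The Poincaré lemma: closed `1`-forms are locally exact. -/
theorem exists_primitive {α : Form1 M} {p : M}
    (hα : ∀ᶠ q in 𝓝 p, ∀ V W, dForm α V W q = 0) :
    ∃ G : CF M, ∀ᶠ q in 𝓝 p, ∀ V : Vec M, V G q = α V q := by
  obtain ⟨C⟩ := nonempty_chartFrame p
  have hC : ∀ᶠ q in 𝓝 p, q ∈ C.U := C.isOpen.mem_nhds C.mem
  obtain ⟨G, hG⟩ := C.primitive (fun i => α (C.X i)) (by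
    filter_upwards [hα, hC] with q h1 h2 i j
    have h3 := h1 (C.X i) (C.X j)
    have h4 : α ⁅C.X i, C.X j⁆ q = 0 := by
      rw [form_congr_at α (W := 0) (fun f => by rw [C.lie_X h2]; rfl), map_zero]
      rfl
    rw [dForm, CF.sub_apply, CF.sub_apply, h4] at h3
    linear_combination h3)
  refine ⟨G, ?_⟩
  filter_upwards [hG, hC] with q h1 h2 V
  rw [C.expand q h2, C.form_expand h2]
  simp only [h1]

namespace Pseudohermitian

variable {S : Pseudohermitian M}

namespace LocalFrame

variable (F : S.LocalFrame)

/-- `P_3 h = 0` for an anti-CR function `h`. -/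
theorem coeff_eq_zero_of_anti {O : Set M} (hO : IsOpen O) (hOU : O ⊆ F.U) {f h : CF M} {c : ℂ}
    (hh : ∀ q ∈ O, F.Z h q = 0) (hf : ∀ q ∈ O, F.Zbar f q = c * F.Zbar h q) {p : M} (hp : p ∈ O) :
    F.coeff f p = 0 := by
  have h1 : ∀ V : Vec M, ∀ q ∈ O, V (F.Z h) q = 0 := fun V q hq =>
    V.apply_eq_zero_of_const hO hh hq
  -- With `h_1 = 0` the first commutator gives `h_{\bar 1 1} = -i h_0`; below, the second gives `Z_1
  -- T h = A_{11} h_{\bar 1}`, which cancels the torsion term.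
  have h2 : ∀ q ∈ O, (F.Z (F.Zbar f) + F.conn F.Z * F.Zbar f) q = ((-c * Complex.I) • F.T h) q := by
    intro q hq
    have h3 := F.commutator_Z_Zbar (hOU hq) h
    rw [h1 _ q hq, hh q hq] at h3
    rw [CF.add_apply, CF.mul_apply, F.Z.congr_on hO (g := c • F.Zbar h) hf hq, hf q hq,
      Derivation.map_smul, CF.smul_apply, CF.smul_apply]
    linear_combination c * h3
  have h4 := F.commutator_T_Z (hOU hp) h
  rw [h1 _ p hp, hh p hp] at h4
  rw [F.coeff_apply (hOU hp), F.Z.congr_on hO h2 hp, hf p hp, Derivation.map_smul, CF.smul_apply]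
  linear_combination c * Complex.I * h4

/-- The coefficient of `θ` is real: by the commutation rule `2 f_{\bar 1 1} + i f_0 = f_{\bar 1 1} +
f_{1 \bar 1}`. -/
theorem conjForm_conjugateForm {p : M} (hp : p ∈ F.U) {f : CF M} (hf : conjF f = f) (V : Vec M) :
    conjForm (F.conjugateForm f) V p = F.conjugateForm f V p := by
  have hs : (starRingEnd ℂ) (F.Zbar f p) = F.Z f p := by
    rw [← conjF_apply, conjF_Zbar, hf]
  have ht : (starRingEnd ℂ) (F.Z f p) = F.Zbar f p := by
    rw [← conjF_apply, conjF_Z, hf]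
  have hZs : (starRingEnd ℂ) (F.Z (F.Zbar f) p) = F.Zbar (F.Z f) p := by
    rw [← conjF_apply, conjF_Z, conjF_Zbar, hf]
  have h1 : conjForm F.θ1 (conjV V) p = (starRingEnd ℂ) (F.θ1 V p) := by
    rw [conjForm_apply, conjV_conjV, conjF_apply]
  have h2 : (starRingEnd ℂ) (F.θ1 (conjV V) p) = conjForm F.θ1 V p := rfl
  have h3 := F.commutator_Z_Zbar hp f
  rw [conjForm_apply, conjF_apply, conjugateForm_apply, conjugateForm_apply, S.θ_conjV, h1]
  simp only [map_add, map_mul, map_neg, hs, ht, hZs, h2, F.conj_conn_Z hp, F.conj_T_apply hp, hf,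
    conjF_apply, Complex.conj_conj, Complex.conj_I, Complex.conj_ofNat]
  linear_combination 2 * S.θ V p * h3

/-- The coefficient of `θ` in `conjugateForm` is the one that makes this component vanish, for every
`f`. -/
theorem dForm_conjugateForm_Z_Zbar {p : M} (hp : p ∈ F.U) (f : CF M) :
    dForm (F.conjugateForm f) F.Z F.Zbar p = 0 := by
  have h1 := F.commutator_Z_Zbar hp f
  have h2 := F.form_expand hp (F.conjugateForm f) ⁅F.Z, F.Zbar⁆
  rw [F.θ_lie_Z_Zbar hp, F.θ1_lie_Z_Zbar hp, F.conjForm_θ1_lie_Z_Zbar hp, F.conjugateForm_T hp,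
    F.conjugateForm_Z hp, F.conjugateForm_Zbar hp] at h2
  rw [dForm, CF.sub_apply, CF.sub_apply,
    F.Z.congr_on F.isOpen (fun q hq => F.conjugateForm_Zbar hq f) hp,
    F.Zbar.congr_on F.isOpen (fun q hq => F.conjugateForm_Z hq f) hp, h2]
  simp only [map_neg, Derivation.map_smul, CF.neg_apply, CF.add_apply, CF.smul_apply, CF.mul_apply]
  linear_combination -Complex.I * h1

/-- In general this component is `2 (f_{\bar 1 1 1} + i A_{11} f_{\bar 1})`: one torsion term comes
from commuting `T` with `Z_1`, the other from the `Z_{\bar 1}`-component of `⁅T, Z_1⁆`. -/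
theorem dForm_conjugateForm_T_Z {p : M} (hp : p ∈ F.U) {f : CF M} (h : F.coeff f p = 0) :
    dForm (F.conjugateForm f) F.T F.Z p = 0 := by
  have h1 := F.commutator_T_Z hp f
  have h2 := F.form_expand hp (F.conjugateForm f) ⁅F.T, F.Z⁆
  rw [F.θ_lie_T_Z hp, F.θ1_lie_T_Z hp, F.conjForm_θ1_lie_T_Z hp, F.conjugateForm_T hp,
    F.conjugateForm_Z hp, F.conjugateForm_Zbar hp] at h2
  rw [F.coeff_apply hp, map_add, CF.add_apply] at h
  rw [dForm, CF.sub_apply, CF.sub_apply,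
    F.T.congr_on F.isOpen (fun q hq => F.conjugateForm_Z hq f) hp,
    F.Z.congr_on F.isOpen (fun q hq => F.conjugateForm_T hq f) hp, h2]
  simp only [map_neg, map_add, Derivation.map_smul, CF.neg_apply, CF.add_apply, CF.smul_apply]
  linear_combination 2 * h - Complex.I * h1

/-- The conjugate of the `(T, Z_1)`-component, as both the form and `T` are real. -/
theorem dForm_conjugateForm_T_Zbar {p : M} (hp : p ∈ F.U) {f : CF M} (hf : conjF f = f)
    (h : F.coeff f p = 0) : dForm (F.conjugateForm f) F.T F.Zbar p = 0 := by
  have h1 : dForm (conjForm (F.conjugateForm f)) F.T F.Z p =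
      dForm (F.conjugateForm f) F.T F.Z p := by
    simp only [dForm, CF.sub_apply, F.conjForm_conjugateForm hp hf]
    rw [F.T.congr_on F.isOpen (fun q hq => F.conjForm_conjugateForm hq hf F.Z) hp,
      F.Z.congr_on F.isOpen (fun q hq => F.conjForm_conjugateForm hq hf F.T) hp]
  rw [← dForm_congr_at _ (F.conjV_T hp) (fun f => rfl), ← conjV_Z, dForm_conjV, conjF_apply, h1,
    F.dForm_conjugateForm_T_Z hp h, map_zero]

theorem dForm_conjugateForm {p : M} (hp : p ∈ F.U) {f : CF M} (hf : conjF f = f)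
    (h : F.coeff f p = 0) (V W : Vec M) : dForm (F.conjugateForm f) V W p = 0 := by
  rw [dForm_expand_at (F.expand hp), F.dForm_conjugateForm_T_Z hp h,
    F.dForm_conjugateForm_T_Zbar hp hf h, F.dForm_conjugateForm_Z_Zbar hp]
  ring

theorem isCROn_of_Zbar {O : Set M} (hOU : O ⊆ F.U) {H : CF M} (hH : ∀ q ∈ O, F.Zbar H q = 0) :
    S.IsCROn H O := fun Z hZ q hq => by
  have h := hH q hq
  rw [Zbar_apply, conjF_apply, map_eq_zero] at h
  rw [conjV_apply, conjF_apply, F.eq_smul_Z hZ (hOU hq), h, mul_zero, map_zero]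

end LocalFrame

/-- Writing `f = (H + conj H) / 2` with `H` CR gives `f_{\bar 1} = (conj H)_{\bar 1} / 2`, and `conj
H` is anti-CR. -/
theorem coeff_eq_zero_of_pluriharmonic {f : CF M} (hf : f ∈ S.pluriharmonic) (F : S.LocalFrame)
    {p : M} (hp : p ∈ F.U) : F.coeff f p = 0 := by
  obtain ⟨U, hU, hpU, H, hH, hfH⟩ := hf p
  have hO : IsOpen (F.U ∩ U) := F.isOpen.inter hU
  have hZb : ∀ q ∈ F.U ∩ U, F.Zbar H q = 0 := fun q hq => hH F.Z F.Z_mem q hq.2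
  refine F.coeff_eq_zero_of_anti (h := conjF H) (c := 1 / 2) hO Set.inter_subset_left
    (fun q hq => ?_) (fun q hq => ?_) ⟨hp, hpU⟩
  · rw [← F.conjF_Zbar, conjF_apply, hZb q hq, map_zero]
  · rw [F.Zbar.congr_on hO (g := (1 / 2 : ℂ) • (H + conjF H)) (fun q hq => ?_) hq,
      Derivation.map_smul, map_add, CF.smul_apply, CF.add_apply, hZb q hq, zero_add]
    rw [hfH q hq.2, CF.smul_apply, CF.add_apply, conjF_apply, Complex.add_conj]
    push_cast
    ring

theorem pluriharmonic_of_coeff_eq_zero {f : CF M} (hf : f ∈ realFunctions M)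
    (h : ∀ F : S.LocalFrame, ∀ p ∈ F.U, F.coeff f p = 0) : f ∈ S.pluriharmonic := fun p => by
  obtain ⟨F, hp⟩ := S.exists_localFrame p
  have hfr := conjF_eq_self hf
  have hU : ∀ᶠ q in 𝓝 p, q ∈ F.U := F.isOpen.mem_nhds hp
  obtain ⟨G, hG⟩ := exists_primitive (α := F.conjugateForm f) (p := p) (by
    filter_upwards [hU] with q hq
    exact F.dForm_conjugateForm hq hfr (h F q hq))
  obtain ⟨O, hO, hOo, hpO⟩ := mem_nhds_iff.1 (hU.and hG)
  -- The primitive `G` may be complex; since the form is real, its real part is again a primitive,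
  -- and the CR function is `f + i Re G`.
  refine ⟨O, hOo, hpO, f + (Complex.I / 2) • (G + conjF G), ?_, fun q _ => ?_⟩
  · refine F.isCROn_of_Zbar (fun q hq => (hO hq).1) fun q hq => ?_
    obtain ⟨hqU, hqG⟩ := hO hq
    rw [map_add, Derivation.map_smul, map_add, CF.add_apply, CF.smul_apply, CF.add_apply,
      ← F.conjF_Z, conjF_apply, hqG, hqG, F.conjugateForm_Z hqU, F.conjugateForm_Zbar hqU,
      CF.neg_apply, CF.smul_apply, CF.smul_apply, map_neg, map_mul, ← conjF_apply (F.Z f),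
      F.conjF_Z, hfr, Complex.conj_I]
    linear_combination F.Zbar f q * Complex.I_mul_I
  · rw [CF.add_apply, CF.smul_apply, CF.add_apply, conjF_apply, Complex.add_conj]
    apply Complex.ext
    · simp
    · simpa using hf q

end Pseudohermitian

end Pluriharmonic

/-! ### Linear relations with a supplementary space -/

section LinearAlgebra

variable {k X Y : Type*} [Ring k] [AddCommMonoid X] [Module k X] [AddCommMonoid Y] [Module k Y]

/-- A single-valued operator on `K = P ⊕ W` with kernel `P` maps `W` isomorphically onto the
image of `K`. -/
theorem IsSupplementary.isIsoOnto {R : Submodule k (X × Y)} {D : Submodule k Y}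
    {K P W : Submodule k X} (hs : IsSupplementary K P W)
    (huniq : ∀ x y z, (x, y) ∈ R → (x, z) ∈ R → y = z)
    (hP : ∀ x, x ∈ P ↔ (x, (0 : Y)) ∈ R) (hK : ∀ x, x ∈ K ↔ ∃ y ∈ D, (x, y) ∈ R) :
    IsIsoOnto R W (D ⊓ relIm R) := by
  obtain ⟨hdis, hsup⟩ := hs
  -- `X` and `Y` are only additive monoids; the scalar `-1` supplies the negatives.
  have hX : ∀ x : X, (-1 : k) • x + x = 0 := fun x => by
    nth_rw 2 [← one_smul k x]
    rw [← add_smul, neg_add_cancel, zero_smul]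
  have hY : ∀ y : Y, (-1 : k) • y + y = 0 := fun y => by
    nth_rw 2 [← one_smul k y]
    rw [← add_smul, neg_add_cancel, zero_smul]
  have hex : ∀ w : W, ∃ y ∈ D, ((w : X), y) ∈ R := fun w =>
    (hK w).1 (hsup ▸ Submodule.mem_sup_right w.2)
  choose g hgD hgR using hex
  let Φ : W →ₗ[k] (D ⊓ relIm R : Submodule k Y) :=
    { toFun := fun w => ⟨g w, hgD w, ⟨_, hgR w, rfl⟩⟩
      map_add' := fun v w => Subtype.ext
        (huniq _ _ _ (hgR (v + w)) (R.add_mem (hgR v) (hgR w)))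
      map_smul' := fun c w => Subtype.ext
        (huniq _ _ _ (hgR (c • w)) (R.smul_mem c (hgR w))) }
  have hinj : Function.Injective Φ := by
    intro v w hvw
    have h0 : g v = g w := congrArg Subtype.val hvw
    have h1 := R.add_mem (R.smul_mem (-1) (hgR v)) (hgR w)
    rw [Prod.smul_mk, Prod.mk_add_mk, h0, hY, ← hP] at h1
    have h2 : (-1 : k) • (v : X) + w ∈ P ⊓ W := ⟨h1, W.add_mem (W.smul_mem _ v.2) w.2⟩
    rw [hdis, Submodule.mem_bot] at h2
    refine Subtype.ext ?_
    calc (v : X) = v + ((-1 : k) • (v : X) + w) := by rw [h2, add_zero]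
      _ = ((-1 : k) • (v : X) + v) + w := by rw [← add_assoc, add_comm (v : X)]
      _ = w := by rw [hX, zero_add]
  have hsurj : Function.Surjective Φ := by
    rintro ⟨y, hyD, ⟨⟨x, y'⟩, hxy, hy'⟩⟩
    obtain rfl : y' = y := hy'
    have hx : x ∈ P ⊔ W := hsup ▸ (hK x).2 ⟨y', hyD, hxy⟩
    obtain ⟨u, hu, w, hw, rfl⟩ := Submodule.mem_sup.1 hx
    refine ⟨⟨w, hw⟩, Subtype.ext (huniq _ _ _ (hgR ⟨w, hw⟩) ?_)⟩
    have := R.add_mem (R.smul_mem (-1) ((hP u).1 hu)) hxy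
    rwa [Prod.smul_mk, Prod.mk_add_mk, ← add_assoc, hX, zero_add, smul_zero, zero_add] at this
  exact ⟨LinearEquiv.ofBijective Φ ⟨hinj, hsurj⟩, hgR⟩

end LinearAlgebra

/-! ### Kernels and images over real and complex functions -/

section Kernels

variable {M : Type*} [TopologicalSpace M] [ChartedSpace (EuclideanSpace ℝ (Fin 3)) M]

theorem mem_onReal {Y : Type*} [AddCommMonoid Y] [Module ℝ Y] [Module ℂ Y] [IsScalarTower ℝ ℂ Y]
    {R : Submodule ℂ (CF M × Y)} {f : CF M} {y : Y} :
    (f, y) ∈ onReal R ↔ (f, y) ∈ R ∧ f ∈ realFunctions M :=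
  ⟨fun h => ⟨h.1, h.2.1⟩, fun h => ⟨h.1, h.2, trivial⟩⟩

namespace Pseudohermitian

variable (S : Pseudohermitian M)

theorem mem_relKer_onReal_P4_iff {R : Submodule ℂ (CF M × Form2 M)}
    (hR : ∀ f, f ∈ relKer S.P4 ↔ ∃ η ∈ relKer S.dbarF20, (f, η) ∈ R) (f : CF M) :
    f ∈ relKer (onReal S.P4) ↔
      ∃ η ∈ (relKer S.dbarF20).restrictScalars ℝ, (f, η) ∈ onReal R := by
  have h : f ∈ relKer (onReal S.P4) ↔ f ∈ relKer S.P4 ∧ f ∈ realFunctions M := mem_onReal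
  rw [h, hR f]
  constructor
  · rintro ⟨⟨η, h1, h2⟩, h3⟩
    exact ⟨η, h1, mem_onReal.2 ⟨h2, h3⟩⟩
  · rintro ⟨η, h1, h2⟩
    exact ⟨⟨η, h1, (mem_onReal.1 h2).1⟩, (mem_onReal.1 h2).2⟩

variable [T2Space M] [IsManifold (𝓡 3) ∞ M]

theorem mem_P3F20_iff_mem_DplusDbar {f : CF M} {η : Form2 M} :
    (f, η) ∈ S.P3F20 ↔ (f, Complex.I • η) ∈ S.DplusDbar := by
  rw [mem_DplusDbar_iff_mem_P3F20, smul_smul, neg_mul, Complex.I_mul_I, neg_neg, one_smul]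

theorem mem_DplusDbar_zero_iff {f : CF M} :
    (f, (0 : Form2 M)) ∈ S.DplusDbar ↔ (f, (0 : Form2 M)) ∈ S.P3F20 := by
  rw [mem_DplusDbar_iff_mem_P3F20, smul_zero]

theorem mem_relKer_P4_iff_DplusDbar {f : CF M} :
    f ∈ relKer S.P4 ↔ ∃ η ∈ relKer S.dbarF20, (f, η) ∈ S.DplusDbar := by
  rw [mem_relKer_P4_iff]
  constructor
  · rintro ⟨η, h1, h2⟩
    exact ⟨Complex.I • η, Submodule.smul_mem _ _ h1, S.mem_P3F20_iff_mem_DplusDbar.1 h2⟩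
  · rintro ⟨η, h1, h2⟩
    exact ⟨-Complex.I • η, Submodule.smul_mem _ _ h1, S.mem_DplusDbar_iff_mem_P3F20.1 h2⟩

/-- The real functions in the kernel of `P_3` are the CR pluriharmonic ones. -/
theorem mem_pluriharmonic_iff {f : CF M} :
    f ∈ S.pluriharmonic ↔ (f, (0 : Form2 M)) ∈ S.P3F20 ∧ f ∈ realFunctions M := by
  rw [mem_P3F20_zero_iff]
  exact ⟨fun h => ⟨fun F _ hp => coeff_eq_zero_of_pluriharmonic h F hp,
    S.pluriharmonic_le_real h⟩, fun h => pluriharmonic_of_coeff_eq_zero h.2 h.1⟩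

/-- `D^+ d'' f = P_3 (i f)`; this uses that the source consists of complex-valued functions. -/
theorem relIm_DplusDbar : relIm S.DplusDbar = relIm S.P3F20 := by
  ext η
  constructor
  · rintro ⟨⟨f, η'⟩, h, rfl⟩
    refine ⟨(Complex.I • f, η'), ?_, rfl⟩
    have := S.P3F20.smul_mem Complex.I (S.mem_DplusDbar_iff_mem_P3F20.1 h)
    rwa [Prod.smul_mk, smul_smul, mul_neg, Complex.I_mul_I, neg_neg, one_smul] at this
  · rintro ⟨⟨f, η'⟩, h, rfl⟩
    refine ⟨(-Complex.I • f, η'), ?_, rfl⟩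
    have := S.DplusDbar.smul_mem (-Complex.I) (S.mem_P3F20_iff_mem_DplusDbar.1 h)
    rwa [Prod.smul_mk, smul_smul, neg_mul, Complex.I_mul_I, neg_neg, one_smul] at this

end Pseudohermitian

end Kernels

end CR

end

theorem lemma2p23 (M : Type*) [TopologicalSpace M] [T2Space M] [SigmaCompactSpace M]
    [ChartedSpace (EuclideanSpace ℝ (Fin 3)) M]
    [IsManifold (𝓡 3) ∞ M]
    (S : CR.Pseudohermitian M) :
    -- `P_3` and `D^+ d''` are everywhere defined, single-valued, and `P_3 = -i D^+ d''`
    (∀ f : CR.CF M, ∃! η, (f, η) ∈ S.P3F20) ∧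
    (∀ f : CR.CF M, ∃! η, (f, η) ∈ S.DplusDbar) ∧
    (∀ (f : CR.CF M) (η : CR.Form2 M),
      (f, η) ∈ S.DplusDbar → (f, -Complex.I • η) ∈ S.P3F20) ∧
    -- real-valued functions, `𝒫` the CR pluriharmonic functions
    (∀ W : Submodule ℝ (CR.CF M),
      CR.IsSupplementary (CR.relKer (CR.onReal S.P4)) S.pluriharmonic W →
        CR.IsIsoOnto (CR.onReal S.P3F20) W
          ((CR.relKer S.dbarF20).restrictScalars ℝ ⊓ CR.relIm (CR.onReal S.P3F20)) ∧
        CR.IsIsoOnto (CR.onReal S.DplusDbar) W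
          ((CR.relKer S.dbarF20).restrictScalars ℝ ⊓ CR.relIm (CR.onReal S.DplusDbar))) ∧
    -- complex-valued functions, `𝒫 = ker P_3`
    (∀ W : Submodule ℂ (CR.CF M),
      CR.IsSupplementary (CR.relKer S.P4) (CR.relKer S.P3) W →
        CR.IsIsoOnto S.P3F20 W (CR.relKer S.dbarF20 ⊓ CR.relIm S.P3F20) ∧
        CR.IsIsoOnto S.P3F20 W (CR.relKer S.dbarF20 ⊓ CR.relIm S.DplusDbar)) := by
  refine ⟨S.existsUnique_mem_P3F20, S.existsUnique_mem_DplusDbar,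
    fun f η => S.mem_DplusDbar_iff_mem_P3F20.1, fun W hW => ⟨?_, ?_⟩, fun W hW => ?_⟩
  · exact hW.isIsoOnto
      (fun f _ _ h h' => (S.existsUnique_mem_P3F20 f).unique
        (CR.mem_onReal.1 h).1 (CR.mem_onReal.1 h').1)
      (fun f => S.mem_pluriharmonic_iff.trans CR.mem_onReal.symm)
      (S.mem_relKer_onReal_P4_iff fun f => S.mem_relKer_P4_iff)
  · exact hW.isIsoOnto
      (fun f _ _ h h' => (S.existsUnique_mem_DplusDbar f).unique
        (CR.mem_onReal.1 h).1 (CR.mem_onReal.1 h').1)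
      (fun f => by rw [CR.mem_onReal, S.mem_DplusDbar_zero_iff, S.mem_pluriharmonic_iff])
      (S.mem_relKer_onReal_P4_iff fun f => S.mem_relKer_P4_iff_DplusDbar)
  · rw [S.relIm_DplusDbar, and_self]
    exact hW.isIsoOnto (fun f _ _ => (S.existsUnique_mem_P3F20 f).unique)
      (fun f => S.mem_relKer_P3_iff) (fun f => S.mem_relKer_P4_iff)
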